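/- For $\mu\subseteq\mathbb N$ finite or co-finite put $d(\mu)=1+\min\{\max\{x: x\in\mu\},\max\{x: x\notin\mu\}\}$, with the conventions $\max\emptyset=-1$ and $\max S=\infty$ for infinite $S$ (so $d(\mathbb N)=0$), and put $d(\sigma,\rho)=\max\{d(\sigma),d(\rho)\}$. For $\sigma,\rho\subseteq\mathbb N$ finite or co-finite, a set $X$ of vertices of a graph $G$ is a $(\sigma,\rho)$-set if $|N(v)\cap X|\in\sigma$ for every $v\in X$ and $|N(v)\cap X|\in\rho$ for every $v\in V(G)\setminus X$. The minimum (maximum) $(\sigma,\rho)$ vertex subset problem asks for the smallest (largest) size of a $(\sigma,\rho)$-set of $G$, or for the information that $G$ has none. Let $G_p=G(n,p)$ be the random graph on $n$ vertices in which each edge is present independently with probability $p$. Every minimum or maximum $(\sigma,\rho)$ vertex subset problem on $G_p$, $p$ constant, can almost surely be solved in $O^*(2^{O(d(\sigma,\rho)\cdot\log^4 n)})$ time. Precisely: there are a constant $c$ and, for every $p\in(0,1]$, a constant $C_p$ such that for all finite or co-finite $\sigma,\rho\subseteq\mathbb N$ and for both the minimum and the maximum problem there is a deterministic algorithm (a program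 of a random access machine with unit-cost addition and subtraction, which receives $G$ as an adjacency matrix) with the following properties. On every finite graph the algorithm halts with the correct answer; and for every fixed $p\in(0,1]$, the probability that it halts on $G_p$ within $$n^{c}\cdot 2^{\,C_p\, d(\sigma,\rho)\,\log_2^4 n}$$ steps tends to $1$ as $n\to\infty$. This includes Max Independent Set and Min Dominating Set: the independent sets of a graph are exactly its $(\{0\},\mathbb N)$-sets, with $d(\{0\},\mathbb N)=1$, and its dominating sets are exactly its $(\mathbb N,\{1,2,\dots\})$-sets, with $d(\mathbb N,\{1,2,\dots\})=1$. -/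

import Mathlib

/-! ## `(σ, ρ)` vertex subset problems -/

/-- `X` is a `(σ, ρ)`-set of `G`: a vertex of `X` has a number of neighbours in `X` that lies in
`σ`, a vertex outside `X` has a number of neighbours in `X` that lies in `ρ`. -/
def IsSigmaRhoSet {V : Type*} (G : SimpleGraph V) (σ ρ : Set ℕ) (X : Set V) : Prop :=
  ∀ v : V, (v ∈ X → (G.neighborSet v ∩ X).ncard ∈ σ) ∧ (v ∉ X → (G.neighborSet v ∩ X).ncard ∈ ρ)

/-- A set of natural numbers that is finite or co-finite. -/
def FinOrCofin (μ : Set ℕ) : Prop := μ.Finite ∨ μᶜ.Finite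

/-- `1 + max μ`, with the conventions `max ∅ = -1` and `max μ = ∞` for infinite `μ`. -/
noncomputable def oneAddMax (μ : Set ℕ) : ℕ∞ := ⨆ x ∈ μ, ((x + 1 : ℕ) : ℕ∞)

/-- `d(μ) = 1 + min (max {x | x ∈ μ}) (max {x | x ∉ μ})`, for `μ` finite or co-finite. The
conventions of `oneAddMax` make `d(ℕ) = 0`. -/
noncomputable def dSet (μ : Set ℕ) : ℕ := (min (oneAddMax μ) (oneAddMax μᶜ)).toNat

/-- `d(σ, ρ) = max (d σ) (d ρ)`. -/
noncomputable def dPair (σ ρ : Set ℕ) : ℕ := max (dSet σ) (dSet ρ)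

theorem oneAddMax_of_isGreatest {μ : Set ℕ} {k : ℕ} (h : IsGreatest μ k) :
    oneAddMax μ = ((k + 1 : ℕ) : ℕ∞) := by
  apply le_antisymm
  · refine iSup₂_le fun x hx => ?_
    have := h.2 hx
    exact_mod_cast Nat.succ_le_succ this
  · exact le_iSup₂ (f := fun x (_ : x ∈ μ) => ((x + 1 : ℕ) : ℕ∞)) k h.1

theorem oneAddMax_of_infinite {μ : Set ℕ} (h : μ.Infinite) : oneAddMax μ = ⊤ := by
  rw [ENat.eq_top_iff_forall_ge]
  intro k
  obtain ⟨x, hx, hk⟩ := h.exists_gt k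
  refine le_trans ?_ (le_iSup₂ (f := fun x (_ : x ∈ μ) => ((x + 1 : ℕ) : ℕ∞)) x hx)
  exact_mod_cast (by omega : k ≤ x + 1)

theorem dSet_compl (μ : Set ℕ) : dSet μᶜ = dSet μ := by
  unfold dSet
  rw [compl_compl, min_comm]

theorem dSet_univ : dSet Set.univ = 0 := by
  simp [dSet, oneAddMax]

/-- If `μ` is finite with largest element `k`, then `d(μ) = 1 + k`. -/
theorem dSet_of_isGreatest {μ : Set ℕ} {k : ℕ} (h : IsGreatest μ k) : dSet μ = k + 1 := by
  have hfin : μ.Finite := (Set.finite_Iic k).subset fun x hx => h.2 hx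
  unfold dSet
  rw [oneAddMax_of_isGreatest h, oneAddMax_of_infinite hfin.infinite_compl, min_top_right]
  rfl

/-- If `μ` is co-finite and `k` is the largest number outside `μ`, then `d(μ) = 1 + k`. -/
theorem dSet_of_isGreatest_compl {μ : Set ℕ} {k : ℕ} (h : IsGreatest μᶜ k) :
    dSet μ = k + 1 := by
  rw [← dSet_compl, dSet_of_isGreatest h]

/-- The two kinds of optimisation problem. -/
inductive Goal
  | minimum
  | maximum

/-- `s` is the least, respectively the greatest, element of `S`. -/
def Goal.IsOptimum (goal : Goal) (S : Set ℕ) (s : ℕ) : Prop :=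
  match goal with
  | .minimum => IsLeast S s
  | .maximum => IsGreatest S s

/-- The sizes of the `(σ, ρ)`-sets of `G`. -/
def sigmaRhoSizes {V : Type*} (G : SimpleGraph V) (σ ρ : Set ℕ) : Set ℕ :=
  {s | ∃ X : Set V, IsSigmaRhoSet G σ ρ X ∧ X.ncard = s}

/-- `out` encodes the answer to the minimum or maximum `(σ, ρ)` vertex subset problem on `G`:
it is `0` if `G` has no `(σ, ρ)`-set, and `s + 1` if the optimum size of a `(σ, ρ)`-set is `s`. -/
def IsAnswer {V : Type*} (goal : Goal) (σ ρ : Set ℕ) (G : SimpleGraph V) (out : ℕ) : Prop :=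
  (sigmaRhoSizes G σ ρ = ∅ ∧ out = 0) ∨
    ∃ s, goal.IsOptimum (sigmaRhoSizes G σ ρ) s ∧ out = s + 1

/-! ## Random access machine programs with a step count

The memory consists of arrays `0, 1, 2, …`, whose cells are indexed by natural numbers and hold
natural numbers. A program mentions finitely many arrays (by fixed names) and addresses their
cells indirectly. The arithmetic is addition and truncated subtraction, at unit cost; there is
no multiplication and there are no bit operations. -/

namespace RAM

/-- The memory: `m a i` is the content of cell `i` of array `a`. -/
abbrev Mem := ℕ → ℕ → ℕ

/-- Overwrite cell `i` of array `a` by `x`. -/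
def Mem.write (m : Mem) (a i x : ℕ) : Mem :=
  fun b j => if b = a ∧ j = i then x else m b j

/-- Expressions: constants, reading a cell, addition, truncated subtraction. -/
inductive Exp
  | lit (k : ℕ)
  | get (a : ℕ) (i : Exp)
  | add (e f : Exp)
  | sub (e f : Exp)

/-- The value of an expression. -/
def Exp.eval (m : Mem) : Exp → ℕ
  | .lit k => k
  | .get a i => m a (i.eval m)
  | .add e f => e.eval m + f.eval m
  | .sub e f => e.eval m - f.eval m

/-- The time to evaluate an expression: one step for each operation in it. -/
def Exp.cost : Exp → ℕ
  | .lit _ => 1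
  | .get _ i => i.cost + 1
  | .add e f => e.cost + f.cost + 1
  | .sub e f => e.cost + f.cost + 1

/-- Programs. -/
inductive Prog
  | skip
  | set (a : ℕ) (i e : Exp)
  | seq (P Q : Prog)
  | ite (e : Exp) (P Q : Prog)
  | loop (e : Exp) (P : Prog)

/-- `Exec P m m' t`: the program `P`, started in memory `m`, halts after exactly `t` steps, in
memory `m'`. A value is true if it is nonzero; `loop e P` repeats `P` as long as `e` is true. -/
inductive Exec : Prog → Mem → Mem → ℕ → Prop
  | skip (m : Mem) : Exec .skip m m 1
  | set (a : ℕ) (i e : Exp) (m : Mem) :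
      Exec (.set a i e) m (m.write a (i.eval m) (e.eval m)) (i.cost + e.cost + 1)
  | seq {P Q : Prog} {m m' m'' : Mem} {t t' : ℕ} :
      Exec P m m' t → Exec Q m' m'' t' → Exec (.seq P Q) m m'' (t + t')
  | ite_true {e : Exp} {P Q : Prog} {m m' : Mem} {t : ℕ} :
      e.eval m ≠ 0 → Exec P m m' t → Exec (.ite e P Q) m m' (e.cost + 1 + t)
  | ite_false {e : Exp} {P Q : Prog} {m m' : Mem} {t : ℕ} :
      e.eval m = 0 → Exec Q m m' t → Exec (.ite e P Q) m m' (e.cost + 1 + t)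
  | loop_stop {e : Exp} {P : Prog} {m : Mem} :
      e.eval m = 0 → Exec (.loop e P) m m (e.cost + 1)
  | loop_step {e : Exp} {P : Prog} {m m' m'' : Mem} {t t' : ℕ} :
      e.eval m ≠ 0 → Exec P m m' t → Exec (.loop e P) m' m'' t' →
        Exec (.loop e P) m m'' (e.cost + 1 + t + t')

/-- Programs are deterministic: result and running time are determined by the initial memory. -/
theorem Exec.deterministic {P : Prog} {m m₁ m₂ : Mem} {t₁ t₂ : ℕ} (h₁ : Exec P m m₁ t₁)
    (h₂ : Exec P m m₂ t₂) : m₁ = m₂ ∧ t₁ = t₂ := by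
  induction h₁ generalizing m₂ t₂ with
  | skip => cases h₂; simp
  | set => cases h₂; simp
  | seq _ _ ih ih' =>
    cases h₂ with
    | seq g g' =>
      obtain ⟨rfl, rfl⟩ := ih g
      obtain ⟨rfl, rfl⟩ := ih' g'
      simp
  | ite_true h _ ih =>
    cases h₂ with
    | ite_true _ g => obtain ⟨rfl, rfl⟩ := ih g; simp
    | ite_false h' _ => exact absurd h' h
  | ite_false h _ ih =>
    cases h₂ with
    | ite_true h' _ => exact absurd h h'
    | ite_false _ g => obtain ⟨rfl, rfl⟩ := ih g; simp
  | loop_stop h =>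
    cases h₂ with
    | loop_stop => simp
    | loop_step h' => exact absurd h h'
  | loop_step h _ _ ih ih' =>
    cases h₂ with
    | loop_stop h' => exact absurd h' h
    | loop_step _ g g' =>
      obtain ⟨rfl, rfl⟩ := ih g
      obtain ⟨rfl, rfl⟩ := ih' g'
      simp

open scoped Classical in
/-- The initial memory for the input graph `G` on the vertices `0, …, n - 1`: cell `0` of array
`0` holds `n`, array `1` holds the adjacency matrix, row by row, and all other cells hold `0`. -/
noncomputable def inputMem {n : ℕ} (G : SimpleGraph (Fin n)) : Mem := fun a i =>
  if a = 0 ∧ i = 0 then n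
  else if a = 1 ∧ ∃ u v : Fin n, G.Adj u v ∧ i = u * n + v then 1
  else 0

/-- `P`, run on the input graph `G`, halts after exactly `t` steps with output `out`, which is
read from cell `0` of array `0`. -/
def Outputs (P : Prog) {n : ℕ} (G : SimpleGraph (Fin n)) (out t : ℕ) : Prop :=
  ∃ m : Mem, Exec P (inputMem G) m t ∧ m 0 0 = out

/-- `P`, run on the input graph `G`, halts after at most `T` steps. -/
def HaltsWithin (P : Prog) {n : ℕ} (G : SimpleGraph (Fin n)) (T : ℝ) : Prop :=
  ∃ out t : ℕ, Outputs P G out t ∧ (t : ℝ) ≤ T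

/-- `P` solves the minimum or maximum `(σ, ρ)` vertex subset problem: on every finite graph it
halts with the right answer. -/
def Solves (P : Prog) (goal : Goal) (σ ρ : Set ℕ) : Prop :=
  ∀ (n : ℕ) (G : SimpleGraph (Fin n)), ∃ out t : ℕ, Outputs P G out t ∧ IsAnswer goal σ ρ G out

end RAM

/-! The algorithm is dynamic programming along the vertex order `0, …, n - 1`. By `min_mem_iff`,
membership of a neighbour count in `σ` or `ρ` depends only on the count truncated at `d = d(σ, ρ)`.
Hence a partial solution may be replaced by its truncated counts across a cut of the order. A
`backEntry` records what a suffix set contributes to the vertices before the cut. A `stateEntry`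
records the size of a prefix set, its contribution to the vertices after the cut, and a prediction
of what the vertices before the cut still receive. A state moves past vertex `i` with the help of a
suffix entry at `i + 1`: the suffix must confirm the old predictions, the constraint at `i` is
checked, and the suffix supplies the new predictions. The program closes two trivial entries under
these moves and reads the sizes off the states at level `n`. `closed_entries` gives soundness, and
`values_eq_sigmaRhoSizes` adds completeness; both hold on every graph.

The running time is polynomial in the number of entries. If no cut has an induced matching of size
`r + 1` across it (edges inside the two sides are ignored), then every set on one side has a subset
of at most `d * r` vertices with the same truncated counts on the other side
(`exists_small_representative`). So there are only `n ^ O(d * r + 1)` entries (`card_entries_le`).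

In the random graph, such a matching requires `r * (r + 1)` prescribed non-edges, so by the union
bound it exists with probability at most `(n ^ 2 * (1 - p) ^ r) ^ (r + 1)`. This tends to `0` for a
suitable `r = O(log n)`, for all cuts at once, so that any vertex order serves. The resulting time
is `n ^ O(1) * 2 ^ O(d * log ^ 2 n)`, well within the claimed bound. -/

/-! ## Reasoning about programs -/

namespace RAM

/-- `P`, started in memory `m`, halts within `T` steps in a memory that satisfies `Q`. -/
def HaltsIn (T : ℕ) (P : Prog) (m : Mem) (Q : Mem → Prop) : Prop :=
  ∃ m' t, Exec P m m' t ∧ t ≤ T ∧ Q m'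

theorem HaltsIn.mono {T T' : ℕ} {P : Prog} {m : Mem} {Q Q' : Mem → Prop} (h : HaltsIn T P m Q)
    (hT : T ≤ T') (hQ : ∀ m', Q m' → Q' m') : HaltsIn T' P m Q' := by
  obtain ⟨m', t, h₁, h₂, h₃⟩ := h
  exact ⟨m', t, h₁, h₂.trans hT, hQ _ h₃⟩

theorem HaltsIn.seq {T T' : ℕ} {P P' : Prog} {m : Mem} {Q : Mem → Prop}
    (h : HaltsIn T P m fun m' => HaltsIn T' P' m' Q) : HaltsIn (T + T') (.seq P P') m Q := by
  obtain ⟨m', t, h₁, h₂, m'', t', h₃, h₄, h₅⟩ := h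
  exact ⟨m'', t + t', .seq h₁ h₃, by omega, h₅⟩

theorem HaltsIn.skip {m : Mem} {Q : Mem → Prop} (h : Q m) : HaltsIn 1 .skip m Q :=
  ⟨m, 1, .skip m, le_rfl, h⟩

theorem HaltsIn.ite {T : ℕ} {e : Exp} {P P' : Prog} {m : Mem} {Q : Mem → Prop}
    (h₁ : e.eval m ≠ 0 → HaltsIn T P m Q) (h₂ : e.eval m = 0 → HaltsIn T P' m Q) :
    HaltsIn (e.cost + 1 + T) (.ite e P P') m Q := by
  by_cases h : e.eval m = 0
  · obtain ⟨m', t, h₃, h₄, h₅⟩ := h₂ h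
    exact ⟨m', _, .ite_false h h₃, by omega, h₅⟩
  · obtain ⟨m', t, h₃, h₄, h₅⟩ := h₁ h
    exact ⟨m', _, .ite_true h h₃, by omega, h₅⟩

/-- The measure `μ` bounds the number of rounds; the summand `1` in `μ m + 1` pays for the final
test of the guard. -/
theorem HaltsIn.loop {T : ℕ} {e : Exp} {P : Prog} (I : Mem → Prop) (μ : Mem → ℕ)
    (step : ∀ m, I m → e.eval m ≠ 0 → HaltsIn T P m fun m' => I m' ∧ μ m' < μ m) {m : Mem}
    (h : I m) :
    HaltsIn ((μ m + 1) * (T + e.cost + 1)) (.loop e P) m fun m' => I m' ∧ e.eval m' = 0 := by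
  induction hk : μ m using Nat.strong_induction_on generalizing m with
  | _ k ih =>
    by_cases he : e.eval m = 0
    · have hx : Exec (.loop e P) m m (e.cost + 1) := by
        constructor
        exact he
      exact ⟨m, _, hx, by nlinarith, h, he⟩
    · obtain ⟨m', t, h₁, h₂, h₃, h₄⟩ := step m h he
      obtain ⟨m'', t', h₅, h₆, h₇⟩ := ih _ (hk ▸ h₄) h₃ rfl
      refine ⟨m'', _, .loop_step he h₁ h₅, ?_, h₇⟩
      have : (μ m' + 1 + 1) * (T + e.cost + 1) ≤ (k + 1) * (T + e.cost + 1) :=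
        Nat.mul_le_mul_right _ (by omega)
      nlinarith

/-- The result of a program without loops. -/
def Prog.run : Prog → Mem → Mem
  | .skip, m => m
  | .set a i e, m => m.write a (i.eval m) (e.eval m)
  | .seq P Q, m => Q.run (P.run m)
  | .ite e P Q, m => if e.eval m = 0 then Q.run m else P.run m
  | .loop _ _, m => m

/-- A bound for the running time of a program without loops. -/
def Prog.time : Prog → ℕ
  | .skip => 1
  | .set _ i e => i.cost + e.cost + 1
  | .seq P Q => P.time + Q.time
  | .ite e P Q => e.cost + 1 + (P.time + Q.time)
  | .loop _ _ => 0

/-- A program has no loops. -/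
def Prog.LoopFree : Prog → Prop
  | .skip => True
  | .set _ _ _ => True
  | .seq P Q => P.LoopFree ∧ Q.LoopFree
  | .ite _ P Q => P.LoopFree ∧ Q.LoopFree
  | .loop _ _ => False

/-- Straight-line code is verified by computing `Prog.run`. `Prog.time` adds the times of both
branches of a conditional, so the bound does not depend on the memory. -/
theorem HaltsIn.of_loopFree {P : Prog} (hP : P.LoopFree) {m : Mem} {Q : Mem → Prop}
    (h : Q (P.run m)) : HaltsIn P.time P m Q := by
  induction P generalizing m Q with
  | skip => exact .skip h
  | set a i e => exact ⟨_, _, .set a i e m, le_rfl, h⟩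
  | seq P P' ih ih' => exact .seq (ih hP.1 (ih' hP.2 h))
  | ite e P P' ih ih' =>
    refine .ite (fun he => ?_) fun he => ?_
    · exact (ih hP.1 (Q := Q) (by simpa [Prog.run, he] using h)).mono (by omega) fun _ h => h
    · exact (ih' hP.2 (Q := Q) (by simpa [Prog.run, he] using h)).mono (by omega) fun _ h => h
  | loop => exact hP.elim

theorem Mem.write_apply (m : Mem) (a i x b j : ℕ) :
    m.write a i x b j = if b = a ∧ j = i then x else m b j := rfl

/-- Consecutive execution of a list of programs. -/
def block : List Prog → Prog
  | [] => .skip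
  | P :: l => .seq P (block l)

/-- The scalar variable that is kept in cell `0` of array `a`. -/
def var (a : ℕ) : Exp := .get a (.lit 0)

/-- Assignment to the scalar variable `a`. -/
def assign (a : ℕ) (e : Exp) : Prog := .set a (.lit 0) e

theorem HaltsIn.assign {a : ℕ} {e : Exp} {m : Mem} {Q : Mem → Prop}
    (h : Q (m.write a 0 (e.eval m))) : HaltsIn (e.cost + 2) (assign a e) m Q :=
  ⟨_, _, .set a (.lit 0) e m, by simp only [Exp.cost]; omega, h⟩

/-- The distance of two numbers. -/
def dist (e f : Exp) : Exp := .add (.sub e f) (.sub f e)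

/-- The smaller one of `d` and `e`. -/
def trunc (d : ℕ) (e : Exp) : Exp := .sub e (.sub e (.lit d))

/-- The number of occurrences of `e` in the list `l`. -/
def count (l : List ℕ) (e : Exp) : Exp :=
  match l with
  | [] => .lit 0
  | k :: l => .add (count l e) (.sub (.lit 1) (dist e (.lit k)))

@[simp] theorem eval_lit (m : Mem) (k : ℕ) : (Exp.lit k).eval m = k := rfl

@[simp] theorem eval_get (m : Mem) (a : ℕ) (i : Exp) : (Exp.get a i).eval m = m a (i.eval m) := rfl

@[simp] theorem eval_add (m : Mem) (e f : Exp) : (Exp.add e f).eval m = e.eval m + f.eval m := rfl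

@[simp] theorem eval_sub (m : Mem) (e f : Exp) : (Exp.sub e f).eval m = e.eval m - f.eval m := rfl

@[simp] theorem eval_var (m : Mem) (a : ℕ) : (var a).eval m = m a 0 := rfl

@[simp] theorem eval_trunc (m : Mem) (d : ℕ) (e : Exp) :
    (trunc d e).eval m = min d (e.eval m) := by
  simp only [trunc, eval_sub, eval_lit]
  omega

theorem eval_dist_eq_zero {m : Mem} {e f : Exp} :
    (dist e f).eval m = 0 ↔ e.eval m = f.eval m := by
  simp only [dist, eval_add, eval_sub]
  omega

theorem eval_count_eq_zero {m : Mem} {l : List ℕ} {e : Exp} :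
    (count l e).eval m = 0 ↔ e.eval m ∉ l := by
  induction l with
  | nil => simp [count]
  | cons k l ih =>
    have := eval_dist_eq_zero (m := m) (e := e) (f := .lit k)
    simp only [count, eval_add, Nat.add_eq_zero_iff, ih, List.mem_cons, not_or, eval_sub, eval_lit]
    rw [eval_lit] at this
    rw [← this, and_comm]
    exact and_congr_left fun _ => by omega

/-- `m'` differs from `m` only in the arrays in `S`. -/
def AgreeOff (S : List ℕ) (m m' : Mem) : Prop := ∀ a, a ∉ S → m' a = m a

theorem AgreeOff.trans {S S' S'' : List ℕ} {m m' m'' : Mem} (h : AgreeOff S m m')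
    (h' : AgreeOff S' m' m'') (h₁ : S ⊆ S'') (h₂ : S' ⊆ S'') : AgreeOff S'' m m'' :=
  fun a ha => (h' a fun h => ha (h₂ h)).trans (h a fun h => ha (h₁ h))

theorem Mem.write_of_ne {m : Mem} {a i x b : ℕ} (h : b ≠ a) : m.write a i x b = m b := by
  funext j
  simp [Mem.write_apply, h]

end RAM

/-! ## The program -/

namespace RAM

/-- The partial solutions that the program tabulates. An entry of kind `0` stands for a set of
vertices `≥ level`, and `digit` gives its truncated numbers of neighbours of the vertices `< level`.
An entry of another kind stands for a set of vertices of which `val` are `< level`, and `digit`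
gives the truncated numbers of neighbours on the other side of the cut at `level`. -/
@[ext] structure Entry (n : ℕ) where
  kind : ℕ
  level : ℕ
  val : ℕ
  digit : Fin n → ℕ

/-- The entry that is stored in array `2` from cell `b` on. -/
def entry (n : ℕ) (m : Mem) (b : ℕ) : Entry n :=
  ⟨m 2 b, m 2 (b + 1), m 2 (b + 2), fun u => m 2 (b + 3 + u)⟩

/-- The number by which `v`, if `x = 1` selects it, increases the number of neighbours of `u`. -/
def gain (n : ℕ) (A : ℕ → ℕ) (x u v : ℕ) : ℕ := x + A (u * n + v) - 1

/-- The entry that results from `P` and `Q` when the next vertex is selected (`x = 1`) or not. -/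
def Entry.combine {n : ℕ} (d : ℕ) (A : ℕ → ℕ) (x : ℕ) (P Q : Entry n) : Entry n :=
  if P.kind = 0 then
    ⟨0, P.level - 1, 0, fun u =>
      if u < P.level - 1 then min d (gain n A x u (P.level - 1) + P.digit u) else 0⟩
  else
    ⟨1, P.level + 1, P.val + x, fun u =>
      if P.level < u then min d (gain n A x u P.level + P.digit u) else Q.digit u⟩

/-- `P` and `Q` can be combined. -/
def Entry.Fits {n : ℕ} (d : ℕ) (A : ℕ → ℕ) (l : List ℕ) (x : ℕ) (P Q : Entry n) : Prop :=
  if P.kind = 0 then P.level ≠ 0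
  else (Q.kind = 0 ∧ Q.level = P.level + 1) ∧ ∀ u : Fin n,
    (u < P.level → min d (gain n A x u P.level + Q.digit u) = P.digit u) ∧
    (u = P.level → min d (P.digit u + Q.digit u) ∈ l)

/-- Header of the new entry. -/
def headProg (x : ℕ) : Prog :=
  .ite (.get 2 (var 7))
    (block [assign 11 (.sub (.lit 1) (.add (.get 2 (var 8))
        (dist (.get 2 (.add (var 8) (.lit 1))) (.add (.get 2 (.add (var 7) (.lit 1))) (.lit 1))))),
      assign 14 (.get 2 (.add (var 7) (.lit 1))),
      .set 2 (.add (var 4) (.lit 2)) (.add (.get 2 (.add (var 7) (.lit 2))) (.lit x)),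
      .set 2 (var 4) (.lit 1),
      .set 2 (.add (var 4) (.lit 1)) (.add (var 14) (.lit 1)),
      assign 10 (.lit 1), assign 12 (.lit 0), assign 13 (.lit 0)])
    (block [assign 11 (.get 2 (.add (var 7) (.lit 1))),
      assign 14 (.sub (var 11) (.lit 1)),
      .set 2 (var 4) (.lit 0),
      .set 2 (.add (var 4) (.lit 1)) (var 14),
      .set 2 (.add (var 4) (.lit 2)) (.lit 0),
      assign 10 (.lit 0), assign 12 (.lit 0), assign 13 (.lit 0)])

/-- Cell of the digit of the current vertex, in the entry that variable `a` points to. -/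
def digitCell (a : ℕ) : Exp := .add (.add (var a) (.lit 3)) (var 12)

/-- The gain of the current vertex. -/
def gainExp (x : ℕ) : Exp := .sub (.add (.lit x) (.get 1 (.add (var 13) (var 14)))) (.lit 1)

/-- One digit of the new entry. -/
def digitProg (d : ℕ) (l : List ℕ) (x : ℕ) : Prog :=
  block [.ite (var 10)
    (.ite (.sub (var 14) (var 12))
      (block [.ite (dist (trunc d (.add (gainExp x) (.get 2 (digitCell 8)))) (.get 2 (digitCell 7)))
          (assign 11 (.lit 0)) .skip,
        .set 2 (digitCell 4) (.get 2 (digitCell 8))])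
      (.ite (.sub (var 12) (var 14))
        (.set 2 (digitCell 4) (trunc d (.add (gainExp x) (.get 2 (digitCell 7)))))
        (block [.ite
            (count l (trunc d (.add (.get 2 (digitCell 7)) (.get 2 (digitCell 8)))))
            .skip (assign 11 (.lit 0)),
          .set 2 (digitCell 4) (.get 2 (digitCell 8))])))
    (.ite (.sub (var 14) (var 12))
      (.set 2 (digitCell 4) (trunc d (.add (gainExp x) (.get 2 (digitCell 7)))))
      (.set 2 (digitCell 4) (.lit 0))),
    assign 12 (.add (var 12) (.lit 1)), assign 13 (.add (var 13) (var 0))]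

/-- Write the combination of the entries `7` and `8` behind the last entry. -/
def combineProg (d : ℕ) (l : List ℕ) (x : ℕ) : Prog :=
  .seq (headProg x) (.loop (.sub (var 0) (var 12)) (digitProg d l x))

/-- The invariant of the loop in `combineProg`. -/
structure CombineInv (n d : ℕ) (A : ℕ → ℕ) (l : List ℕ) (x : ℕ) (m₀ m : Mem) : Prop where
  agree : AgreeOff [2, 10, 11, 12, 13, 14] m₀ m
  below : ∀ i < m₀ 4 0, m 2 i = m₀ 2 i
  le : m 12 0 ≤ n
  row : m 13 0 = m 12 0 * n
  kind : m 10 0 = 0 ↔ m₀ 2 (m₀ 7 0) = 0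
  level : m 14 0 = if m₀ 2 (m₀ 7 0) = 0 then m₀ 2 (m₀ 7 0 + 1) - 1 else m₀ 2 (m₀ 7 0 + 1)
  head : m 2 (m₀ 4 0) = ((entry n m₀ (m₀ 7 0)).combine d A x (entry n m₀ (m₀ 8 0))).kind ∧
    m 2 (m₀ 4 0 + 1) = ((entry n m₀ (m₀ 7 0)).combine d A x (entry n m₀ (m₀ 8 0))).level ∧
    m 2 (m₀ 4 0 + 2) = ((entry n m₀ (m₀ 7 0)).combine d A x (entry n m₀ (m₀ 8 0))).val
  digit : ∀ u : Fin n, u < m 12 0 → m 2 (m₀ 4 0 + 3 + u) =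
    ((entry n m₀ (m₀ 7 0)).combine d A x (entry n m₀ (m₀ 8 0))).digit u
  fits : m 11 0 ≠ 0 ↔
    if m₀ 2 (m₀ 7 0) = 0 then m₀ 2 (m₀ 7 0 + 1) ≠ 0
    else (m₀ 2 (m₀ 8 0) = 0 ∧ m₀ 2 (m₀ 8 0 + 1) = m₀ 2 (m₀ 7 0 + 1) + 1) ∧
      ∀ u : Fin n, u < m 12 0 →
        (u < m₀ 2 (m₀ 7 0 + 1) → min d (gain n A x u (m₀ 2 (m₀ 7 0 + 1)) +
          m₀ 2 (m₀ 8 0 + 3 + u)) = m₀ 2 (m₀ 7 0 + 3 + u)) ∧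
        (u = m₀ 2 (m₀ 7 0 + 1) → min d (m₀ 2 (m₀ 7 0 + 3 + u) + m₀ 2 (m₀ 8 0 + 3 + u)) ∈ l)

theorem headProg_spec {n d : ℕ} {A : ℕ → ℕ} {l : List ℕ} {x : ℕ} {m : Mem} :
    CombineInv n d A l x m ((headProg x).run m) := by
  by_cases hk : m 2 (m 7 0) = 0
  · have hrun : (headProg x).run m = ((((((((m.write 11 0 (m 2 (m 7 0 + 1))).write 14 0
        (m 2 (m 7 0 + 1) - 1)).write 2 (m 4 0) 0).write 2 (m 4 0 + 1)
        (m 2 (m 7 0 + 1) - 1)).write 2 (m 4 0 + 2) 0).write 10 0 0).write 12 0 0).write 13 0 0) := by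
      simp [headProg, block, assign, Prog.run, Mem.write_apply, hk]
    rw [hrun]
    constructor
    · intro a ha
      simp only [List.mem_cons, not_or] at ha
      simp [Mem.write_of_ne, ha]
    · intro i hi
      simp only [Mem.write_apply]
      have h1 : i ≠ m 4 0 := by omega
      have h2 : i ≠ m 4 0 + 1 := by omega
      have h3 : i ≠ m 4 0 + 2 := by omega
      simp [h1, h2, h3]
    all_goals simp [Mem.write_apply, hk, Entry.combine, entry]
  · have hrun : (headProg x).run m = ((((((((m.write 11 0 (1 - (m 2 (m 8 0) +
        (dist (.get 2 (.add (var 8) (.lit 1)))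
          (.add (.get 2 (.add (var 7) (.lit 1))) (.lit 1))).eval m))).write 14 0
        (m 2 (m 7 0 + 1))).write 2 (m 4 0 + 2) (m 2 (m 7 0 + 2) + x)).write 2 (m 4 0) 1).write 2
        (m 4 0 + 1) (m 2 (m 7 0 + 1) + 1)).write 10 0 1).write 12 0 0).write 13 0 0) := by
      simp [headProg, block, assign, Prog.run, Mem.write_apply, hk]
    rw [hrun]
    have hd := eval_dist_eq_zero (m := m) (e := .get 2 (.add (var 8) (.lit 1)))
      (f := .add (.get 2 (.add (var 7) (.lit 1))) (.lit 1))
    simp only [eval_get, eval_add, eval_var, eval_lit] at hd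
    constructor
    · intro a ha
      simp only [List.mem_cons, not_or] at ha
      simp [Mem.write_of_ne, ha]
    · intro i hi
      simp only [Mem.write_apply]
      have h1 : i ≠ m 4 0 := by omega
      have h2 : i ≠ m 4 0 + 1 := by omega
      have h3 : i ≠ m 4 0 + 2 := by omega
      simp [h1, h2, h3]
    all_goals simp [Mem.write_apply, hk, Entry.combine, entry]
    -- The flag is `1 - (kind + distance of levels)`, which is nonzero exactly if both summands
    -- vanish.
    rw [← hd]
    omega

-- One round of the loop, seen only through its effect: `b` says whether the test at the current
-- vertex passes, and `z` is the digit written. Every branch of `digitProg` has this shape, so the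
-- invariant is re-established only once.
open scoped Classical in
theorem CombineInv.step {n d : ℕ} {A : ℕ → ℕ} {l : List ℕ} {x : ℕ} {m₀ m m' : Mem}
    (h : CombineInv n d A l x m₀ m) (hu : m 12 0 < n) (b : Prop) (z : ℕ)
    (hm' : m' = (((if b then m else m.write 11 0 0).write 2 (m₀ 4 0 + 3 + m 12 0) z).write 12 0
      (m 12 0 + 1)).write 13 0 (m 12 0 * n + n))
    (hz : z = ((entry n m₀ (m₀ 7 0)).combine d A x (entry n m₀ (m₀ 8 0))).digit ⟨m 12 0, hu⟩)
    (hb : b ↔ (m₀ 2 (m₀ 7 0) ≠ 0 →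
        (m 12 0 < m₀ 2 (m₀ 7 0 + 1) → min d (gain n A x (m 12 0) (m₀ 2 (m₀ 7 0 + 1)) +
          m₀ 2 (m₀ 8 0 + 3 + m 12 0)) = m₀ 2 (m₀ 7 0 + 3 + m 12 0)) ∧
        (m 12 0 = m₀ 2 (m₀ 7 0 + 1) →
          min d (m₀ 2 (m₀ 7 0 + 3 + m 12 0) + m₀ 2 (m₀ 8 0 + 3 + m 12 0)) ∈ l))) :
    CombineInv n d A l x m₀ m' ∧ m' 12 0 = m 12 0 + 1 := by
  have h12 : m' 12 0 = m 12 0 + 1 := by simp [hm', Mem.write_apply]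
  have h2 : ∀ i, i ≠ m₀ 4 0 + 3 + m 12 0 → m' 2 i = m 2 i := by
    intro i hi
    rw [hm']
    by_cases hb : b <;> simp [hb, Mem.write_apply, hi]
  have h11 : m' 11 0 ≠ 0 ↔ m 11 0 ≠ 0 ∧ b := by
    rw [hm']
    by_cases hb : b <;> simp [hb, Mem.write_apply]
  have h10 : m' 10 0 = m 10 0 := by
    rw [hm']
    by_cases hb : b <;> simp [hb, Mem.write_apply]
  have h14 : m' 14 0 = m 14 0 := by
    rw [hm']
    by_cases hb : b <;> simp [hb, Mem.write_apply]
  refine ⟨⟨?_, ?_, ?_, ?_, ?_, ?_, ?_, ?_, ?_⟩, h12⟩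
  · intro a ha
    rw [← h.agree a ha]
    simp only [List.mem_cons, not_or] at ha
    rw [hm']
    by_cases hb : b <;> simp [hb, Mem.write_of_ne, ha]
  · intro i hi
    rw [h2 i (by omega), h.below i hi]
  · omega
  · rw [h12, hm', add_mul, one_mul]
    simp [Mem.write_apply]
  · rw [h10, h.kind]
  · rw [h14, h.level]
  · rw [h2 _ (by omega), h2 _ (by omega), h2 _ (by omega)]
    exact h.head
  · intro u hu'
    rw [h12] at hu'
    by_cases hu'' : (u : ℕ) = m 12 0
    · have : u = ⟨m 12 0, hu⟩ := Fin.ext hu''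
      rw [this, ← hz, hm']
      simp [Mem.write_apply]
    · rw [h2 _ (by omega), h.digit u (by omega)]
  · rw [h11, h.fits, h12]
    by_cases hk : m₀ 2 (m₀ 7 0) = 0
    · simp [hb, hk]
    · simp only [hk, if_false, hb, ne_eq, not_false_eq_true, forall_true_left, and_assoc]
      refine and_congr_right fun _ => and_congr_right fun _ => ⟨?_, fun h => ⟨?_, ?_⟩⟩
      · rintro ⟨h₁, h₂⟩ u hu'
        by_cases hu'' : (u : ℕ) = m 12 0
        · rw [hu'']
          exact h₂
        · exact h₁ u (by omega)
      · exact fun u hu' => h u (by omega)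
      · exact h ⟨m 12 0, hu⟩ (Nat.lt_succ_self _)

theorem digitProg_spec {n d : ℕ} {A : ℕ → ℕ} {l : List ℕ} {x : ℕ} {m₀ m : Mem}
    (hn : m₀ 0 0 = n) (hA : m₀ 1 = A)
    (h7 : m₀ 7 0 + (n + 3) ≤ m₀ 4 0) (h8 : m₀ 8 0 + (n + 3) ≤ m₀ 4 0)
    (h : CombineInv n d A l x m₀ m) (hu : m 12 0 < n) :
    CombineInv n d A l x m₀ ((digitProg d l x).run m) ∧
      ((digitProg d l x).run m) 12 0 = m 12 0 + 1 := by
  have g0 : m 0 0 = n := by rw [h.agree 0 (by simp), hn]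
  have g1 : m 1 = A := by rw [h.agree 1 (by simp), hA]
  have g4 : m 4 0 = m₀ 4 0 := by rw [h.agree 4 (by simp)]
  have g7 : m 7 0 = m₀ 7 0 := by rw [h.agree 7 (by simp)]
  have g8 : m 8 0 = m₀ 8 0 := by rw [h.agree 8 (by simp)]
  have e7 : m 2 (m₀ 7 0 + 3 + m 12 0) = m₀ 2 (m₀ 7 0 + 3 + m 12 0) := h.below _ (by omega)
  have e8 : m 2 (m₀ 8 0 + 3 + m 12 0) = m₀ 2 (m₀ 8 0 + 3 + m 12 0) := h.below _ (by omega)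
  have hr := h.row
  have hl := h.level
  have hk' := h.kind
  by_cases hk : m₀ 2 (m₀ 7 0) = 0
  · simp only [hk, if_true, iff_true] at hl hk'
    by_cases h₁ : m 12 0 < m 14 0
    · have h₁' : m 14 0 - m 12 0 ≠ 0 := by omega
      refine h.step hu True (min d (gain n A x (m 12 0) (m 14 0) + m₀ 2 (m₀ 7 0 + 3 + m 12 0)))
        ?_ ?_ (by simp [hk])
      · simp [digitProg, block, assign, Prog.run, hk', h₁', digitCell, gainExp, Mem.write_apply,
          g0, g1, g4, g7, e7, hr, gain]
      · simp [Entry.combine, entry, hk, ← hl, h₁]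
    · have h₁' : m 14 0 - m 12 0 = 0 := by omega
      refine h.step hu True 0 ?_ ?_ (by simp [hk])
      · simp [digitProg, block, assign, Prog.run, hk', h₁', digitCell, Mem.write_apply,
          g0, g4, hr]
      · simp [Entry.combine, entry, hk, ← hl, h₁]
  · simp only [hk, if_false, iff_false] at hl hk'
    -- Here cell `14` holds the level of `P`. Before the level the prediction of `P` is tested, at
    -- the level the constraint of the vertex is tested, and beyond it only a count is updated.
    rcases lt_trichotomy (m 12 0) (m 14 0) with h₁ | h₁ | h₁
    · have h₁' : m 14 0 - m 12 0 ≠ 0 := by omega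
      have hd := eval_dist_eq_zero (m := m)
        (e := trunc d (.add (gainExp x) (.get 2 (digitCell 8)))) (f := .get 2 (digitCell 7))
      simp only [eval_trunc, eval_add, eval_get, gainExp, digitCell, eval_sub, eval_var, eval_lit,
        g1, g7, g8, e7, e8, hr] at hd
      refine h.step hu (min d (gain n A x (m 12 0) (m 14 0) +
          m₀ 2 (m₀ 8 0 + 3 + m 12 0)) = m₀ 2 (m₀ 7 0 + 3 + m 12 0)) (m₀ 2 (m₀ 8 0 + 3 + m 12 0))
        ?_ ?_ ?_
      · by_cases hx : min d (gain n A x (m 12 0) (m 14 0) + m₀ 2 (m₀ 8 0 + 3 + m 12 0)) =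
          m₀ 2 (m₀ 7 0 + 3 + m 12 0)
        · rw [if_pos hx]
          rw [gain] at hx
          simp [digitProg, block, assign, Prog.run, hk', h₁', digitCell, gainExp, hd, hx,
            Mem.write_apply, g0, g4, g8, e8, hr]
        · rw [if_neg hx]
          rw [gain] at hx
          simp [digitProg, block, assign, Prog.run, hk', h₁', digitCell, gainExp, hd, hx,
            Mem.write_apply, g0, g4, g8, e8, hr]
      · simp [Entry.combine, entry, hk, ← hl, h₁.not_gt]
      · simp [hk, ← hl, h₁, h₁.ne]
    · have h₁' : m 14 0 - m 12 0 = 0 := by omega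
      have h₁'' : m 12 0 - m 14 0 = 0 := by omega
      have hd := eval_count_eq_zero (m := m) (l := l)
        (e := trunc d (.add (.get 2 (digitCell 7)) (.get 2 (digitCell 8))))
      simp only [eval_trunc, eval_add, eval_get, digitCell, eval_var, eval_lit,
        g7, g8, e7, e8] at hd
      refine h.step hu (min d (m₀ 2 (m₀ 7 0 + 3 + m 12 0) +
          m₀ 2 (m₀ 8 0 + 3 + m 12 0)) ∈ l) (m₀ 2 (m₀ 8 0 + 3 + m 12 0)) ?_ ?_ ?_
      · simp only [digitProg, block, assign, Prog.run, hk', h₁', h₁'', digitCell, eval_sub,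
          eval_add, eval_lit, eval_var, eval_get, if_false, if_true, hd]
        split_ifs <;> first | contradiction | simp [Mem.write_apply, g0, g4, g8, e8, hr]
      · simp [Entry.combine, entry, hk, ← hl, h₁]
      · simp [hk, ← hl, h₁]
    · have h₁' : m 14 0 - m 12 0 = 0 := by omega
      have h₁'' : m 12 0 - m 14 0 ≠ 0 := by omega
      refine h.step hu True (min d (gain n A x (m 12 0) (m 14 0) + m₀ 2 (m₀ 7 0 + 3 + m 12 0)))
        ?_ ?_ ?_
      · simp [digitProg, block, assign, Prog.run, hk', h₁', h₁'', digitCell, gainExp,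
          Mem.write_apply, g0, g1, g4, g7, e7, hr, gain]
      · simp [Entry.combine, entry, hk, ← hl, h₁]
      · simp [hk, ← hl, h₁.not_gt, h₁.ne']

/-- Both operands lie below the end `m 4 0` of the table, so writing behind the end does not disturb
them. The new entry is written even if it does not fit; it counts only once the end is moved. -/
theorem combineProg_spec {n d : ℕ} {A : ℕ → ℕ} {l : List ℕ} {x : ℕ} {m : Mem}
    (hn : m 0 0 = n) (hA : m 1 = A)
    (h7 : m 7 0 + (n + 3) ≤ m 4 0) (h8 : m 8 0 + (n + 3) ≤ m 4 0) :
    HaltsIn ((headProg x).time + (n + 1) * ((digitProg d l x).time + 6)) (combineProg d l x) m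
      fun m' => AgreeOff [2, 10, 11, 12, 13, 14] m m' ∧ (∀ i < m 4 0, m' 2 i = m 2 i) ∧
        entry n m' (m 4 0) = (entry n m (m 7 0)).combine d A x (entry n m (m 8 0)) ∧
        (m' 11 0 ≠ 0 ↔ (entry n m (m 7 0)).Fits d A l x (entry n m (m 8 0))) := by
  refine .seq (.of_loopFree (by simp [headProg, block, assign, Prog.LoopFree]) ?_)
  have h := headProg_spec (d := d) (A := A) (l := l) (x := x) (m := m) (n := n)
  refine (HaltsIn.loop (T := (digitProg d l x).time) (CombineInv n d A l x m) (fun m' => n - m' 12 0) ?_ h).mono ?_ ?_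
  · intro m' hI he
    have hu : m' 12 0 < n := by
      simp only [eval_sub, eval_var, hI.agree 0 (by simp), hn] at he
      omega
    refine .of_loopFree (by simp [digitProg, block, assign, Prog.LoopFree]) ?_
    have := digitProg_spec hn hA h7 h8 hI hu
    exact ⟨this.1, by omega⟩
  · exact Nat.mul_le_mul (by omega) (by simp [Exp.cost, var])
  · rintro m' ⟨hI, he⟩
    simp only [eval_sub, eval_var, hI.agree 0 (by simp), hn] at he
    have hu : m' 12 0 = n := le_antisymm hI.le (by omega)
    refine ⟨hI.agree, hI.below, ?_, ?_⟩
    · obtain ⟨h₁, h₂, h₃⟩ := hI.head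
      exact Entry.ext h₁ h₂ h₃ (funext fun u => hI.digit u (hu ▸ u.2))
    · rw [hI.fits, Entry.Fits, hu]
      by_cases hk : m 2 (m 7 0) = 0 <;> simp [hk, entry]

/-! ### Comparing, searching and inserting entries of the table. -/

theorem entry_eq_iff {n : ℕ} {m m' : Mem} {b b' : ℕ} :
    entry n m b = entry n m' b' ↔ ∀ j < n + 3, m 2 (b + j) = m' 2 (b' + j) := by
  constructor
  · intro h j hj
    simp only [entry, Entry.mk.injEq] at h
    obtain ⟨h₀, h₁, h₂, h₃⟩ := h
    rcases j with _ | _ | _ | j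
    · exact h₀
    · exact h₁
    · exact h₂
    · have := congrFun h₃ ⟨j, by omega⟩
      simp only at this
      rw [show b + (j + 1 + 1 + 1) = b + 3 + j by omega, this,
        show b' + (j + 1 + 1 + 1) = b' + 3 + j by omega]
  · intro h
    refine Entry.ext (h 0 (by omega)) (h 1 (by omega)) (h 2 (by omega)) (funext fun u => ?_)
    have := h (3 + u) (by omega)
    rwa [← add_assoc, ← add_assoc] at this

/-- The memory contains the entries in `L`, one after the other. -/
structure Stores {n : ℕ} (m : Mem) (L : List (Entry n)) : Prop where
  length : m 4 0 = L.length * (n + 3)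
  entry : ∀ (i : ℕ) (h : i < L.length), entry n m (i * (n + 3)) = L[i]

/-- Compare the entry that variable `13` points to with the new entry. -/
def compareProg : Prog :=
  block [assign 12 (.lit 0), assign 14 (.lit 0),
    .loop (.sub (var 3) (var 12)) (block [assign 14 (.add (var 14)
        (dist (.get 2 (.add (var 13) (var 12))) (.get 2 (.add (var 4) (var 12))))),
      assign 12 (.add (var 12) (.lit 1))])]

/-- Cell `14` accumulates the distances of corresponding cells and stays `0` exactly as long as all
of them agree. -/
theorem compareProg_spec {n : ℕ} {m : Mem} (hW : m 3 0 = n + 3) :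
    HaltsIn (100 * (n + 4)) compareProg m fun m' => AgreeOff [12, 14] m m' ∧
      (m' 14 0 = 0 ↔ entry n m (m 13 0) = entry n m (m 4 0)) := by
  have key := HaltsIn.loop (T := (block [assign 14 (.add (var 14)
        (dist (.get 2 (.add (var 13) (var 12))) (.get 2 (.add (var 4) (var 12))))),
      assign 12 (.add (var 12) (.lit 1))]).time) (e := .sub (var 3) (var 12))
      (P := block [assign 14 (.add (var 14)
        (dist (.get 2 (.add (var 13) (var 12))) (.get 2 (.add (var 4) (var 12))))),
      assign 12 (.add (var 12) (.lit 1))])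
    (fun m' => AgreeOff [12, 14] m m' ∧ m' 12 0 ≤ n + 3 ∧
      (m' 14 0 = 0 ↔ ∀ j < m' 12 0, m 2 (m 13 0 + j) = m 2 (m 4 0 + j)))
    (fun m' => n + 3 - m' 12 0) (fun m' hI he => ?_) (m := (m.write 12 0 0).write 14 0 0) ?_
  · have h : HaltsIn _ compareProg m _ := .seq (.assign
      (.seq (.assign (.seq (key.mono le_rfl fun m' hI => .skip hI)))))
    refine h.mono ?_ ?_
    · simp [Prog.time, Exp.cost, var, assign, block, dist, Mem.write_apply]
      omega
    · rintro m' ⟨⟨h₁, h₂, h₃⟩, h₄⟩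
      refine ⟨h₁, ?_⟩
      simp only [eval_sub, eval_var, h₁ 3 (by simp), hW] at h₄
      rw [h₃, entry_eq_iff, show m' 12 0 = n + 3 by omega]
  · obtain ⟨h₁, h₂, h₃⟩ := hI
    simp only [eval_sub, eval_var, h₁ 3 (by simp), hW] at he
    refine .of_loopFree (by simp [block, assign, Prog.LoopFree]) ?_
    have hd := eval_dist_eq_zero (m := m') (e := .get 2 (.add (var 13) (var 12)))
      (f := .get 2 (.add (var 4) (var 12)))
    simp only [eval_get, eval_add, eval_var, h₁ 2 (by simp), h₁ 13 (by simp), h₁ 4 (by simp)] at hd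
    simp only [block, assign, Prog.run, eval_lit, eval_add, eval_var]
    refine ⟨⟨?_, ?_, ?_⟩, ?_⟩
    · intro a ha
      rw [← h₁ a ha]
      simp only [List.mem_cons, not_or] at ha
      simp [Mem.write_of_ne, ha]
    · simp [Mem.write_apply]
      omega
    · simp only [Mem.write_apply]
      simp only [h₃, Nat.add_eq_zero_iff, hd, and_self, if_true, Nat.lt_succ_iff_lt_or_eq,
        Nat.reduceEqDiff, if_false, false_and]
      constructor
      · rintro ⟨h₅, h₆⟩ j (hj | rfl)
        · exact h₅ j hj
        · exact h₆
      · exact fun h => ⟨fun j hj => h j (.inl hj), h _ (.inr rfl)⟩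
    · simp [Mem.write_apply]
      omega
  · refine ⟨?_, ?_, ?_⟩
    · intro a ha
      simp only [List.mem_cons, not_or] at ha
      simp [Mem.write_of_ne, ha]
    · simp [Mem.write_apply]
    · simp [Mem.write_apply]

/-- Search the new entry among the old ones. -/
def searchProg : Prog :=
  block [assign 10 (.lit 0), assign 13 (.lit 0),
    .loop (.sub (var 4) (var 13))
      (.seq compareProg (block [.ite (var 14) .skip (assign 10 (.lit 1)),
        assign 13 (.add (var 13) (var 3))]))]

theorem searchProg_spec {n : ℕ} {m : Mem} {L : List (Entry n)} (hW : m 3 0 = n + 3)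
    (hL : Stores m L) :
    HaltsIn ((m 4 0 + 1) * (200 * (n + 4))) searchProg m fun m' => AgreeOff [10, 12, 13, 14] m m' ∧
      (m' 10 0 ≠ 0 ↔ entry n m (m 4 0) ∈ L) := by
  have key := HaltsIn.loop (T := 100 * (n + 4) + 50) (e := .sub (var 4) (var 13))
    (P := .seq compareProg (block [.ite (var 14) .skip (assign 10 (.lit 1)),
        assign 13 (.add (var 13) (var 3))]))
    (fun m' => AgreeOff [10, 12, 13, 14] m m' ∧ ∃ k ≤ L.length, m' 13 0 = k * (n + 3) ∧
      (m' 10 0 ≠ 0 ↔ ∃ (i : ℕ) (h : i < L.length), i < k ∧ L[i] = entry n m (m 4 0)))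
    (fun m' => m 4 0 - m' 13 0) (fun m' hI he => ?_) (m := (m.write 10 0 0).write 13 0 0) ?_
  · have h : HaltsIn _ searchProg m _ := .seq (.assign
      (.seq (.assign (.seq (key.mono le_rfl fun m' hI => .skip hI)))))
    refine h.mono ?_ ?_
    · simp only [Exp.cost, var, Mem.write_apply]
      norm_num
      nlinarith
    · rintro m' ⟨⟨h₁, k, hk, h₂, h₃⟩, h₄⟩
      refine ⟨h₁, ?_⟩
      simp only [eval_sub, eval_var, h₁ 4 (by simp), hL.length, h₂] at h₄
      have : k = L.length := by
        refine le_antisymm hk ?_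
        exact Nat.le_of_mul_le_mul_right (Nat.le_of_sub_eq_zero h₄) (by omega)
      rw [h₃, List.mem_iff_getElem, this]
      exact ⟨fun ⟨i, h, _, h'⟩ => ⟨i, h, h'⟩, fun ⟨i, h, h'⟩ => ⟨i, h, h, h'⟩⟩
  · obtain ⟨h₁, k, hk, h₂, h₃⟩ := hI
    have hk' : k < L.length := by
      simp only [eval_sub, eval_var, h₁ 4 (by simp), hL.length, h₂] at he
      by_contra hc
      exact he (Nat.sub_eq_zero_of_le (Nat.mul_le_mul_right _ (not_lt.1 hc)))
    have hlt : m' 13 0 < m 4 0 := by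
      rw [h₂, hL.length]
      exact Nat.mul_lt_mul_of_pos_right hk' (by omega)
    refine .mono (.seq ((compareProg_spec ((congrFun (h₁ 3 (by simp)) 0).trans hW)).mono le_rfl ?_))
      (T := 100 * (n + 4) + (block [.ite (var 14) .skip (assign 10 (.lit 1)),
        assign 13 (.add (var 13) (var 3))]).time)
      (by simp [Prog.time, Exp.cost, var, assign, block]) fun _ h => h
    rintro m'' ⟨h₄, h₅⟩
    have h₅' : m'' 14 0 = 0 ↔ L[k] = entry n m (m 4 0) := by
      rw [h₅, ← hL.entry k hk', h₂, h₁ 4 (by simp)]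
      simp only [entry, h₁ 2 (by simp)]
    have h₆ : AgreeOff [10, 12, 13, 14] m m'' := h₁.trans h₄ (by simp) (by simp)
    refine .of_loopFree (by simp [block, assign, Prog.LoopFree]) ?_
    have h13 : m'' 13 0 = m' 13 0 := congrFun (h₄ 13 (by simp)) 0
    have h10 : m'' 10 0 = m' 10 0 := congrFun (h₄ 10 (by simp)) 0
    have h3 : m'' 3 0 = n + 3 := (congrFun (h₆ 3 (by simp)) 0).trans hW
    have hrun : ∃ z, (block [.ite (var 14) .skip (assign 10 (.lit 1)),
        assign 13 (.add (var 13) (var 3))]).run m'' =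
          (m''.write 10 0 z).write 13 0 ((k + 1) * (n + 3)) ∧
          (z ≠ 0 ↔ m' 10 0 ≠ 0 ∨ L[k] = entry n m (m 4 0)) := by
      by_cases h0 : m'' 14 0 = 0
      · refine ⟨1, ?_, by simp [h₅'.1 h0]⟩
        simp [block, assign, Prog.run, h0, Mem.write_apply, h13, h3, h₂, add_mul]
      · refine ⟨m'' 10 0, ?_, by simp [h10, mt h₅'.2 h0]⟩
        have : m''.write 10 0 (m'' 10 0) = m'' := by
          funext a i
          rw [Mem.write_apply]
          split_ifs with h
          · rw [h.1, h.2]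
          · rfl
        rw [this]
        simp [block, assign, Prog.run, h0, h13, h3, h₂, add_mul]
    obtain ⟨z, hz, hz'⟩ := hrun
    rw [hz]
    refine ⟨⟨?_, k + 1, hk', ?_, ?_⟩, ?_⟩
    · intro a ha
      rw [← h₆ a ha]
      simp only [List.mem_cons, not_or] at ha
      simp [Mem.write_of_ne, ha]
    · simp [Mem.write_apply]
    · rw [show ((m''.write 10 0 z).write 13 0 ((k + 1) * (n + 3))) 10 0 = z by
        simp [Mem.write_apply], hz', h₃]
      constructor
      · rintro (⟨i, h, h', h''⟩ | h)
        · exact ⟨i, h, by omega, h''⟩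
        · exact ⟨k, hk', by omega, h⟩
      · rintro ⟨i, h, h', h''⟩
        rcases Nat.lt_succ_iff_lt_or_eq.1 h' with h' | rfl
        · exact .inl ⟨i, h, h', h''⟩
        · exact .inr h''
    · rw [show ((m''.write 10 0 z).write 13 0 ((k + 1) * (n + 3))) 13 0 = (k + 1) * (n + 3) by
        simp [Mem.write_apply]]
      rw [h₂] at hlt ⊢
      rw [add_mul]
      omega
  · refine ⟨?_, 0, by omega, ?_, ?_⟩
    · intro a ha
      simp only [List.mem_cons, not_or] at ha
      simp [Mem.write_of_ne, ha]
    · simp [Mem.write_apply]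
    · simp [Mem.write_apply]

/-- Keep the new entry if it can be formed and is not yet present. -/
def insertProg : Prog :=
  .ite (var 11) (.seq searchProg (.ite (var 10) .skip (assign 4 (.add (var 4) (var 3))))) .skip

/-- Keeping the candidate means moving the end of the table past it. Refusing duplicates bounds the
table by the number of possible entries, which later makes the closure terminate. -/
theorem insertProg_spec {n : ℕ} {m : Mem} {L : List (Entry n)} (hW : m 3 0 = n + 3)
    (hL : Stores m L) :
    HaltsIn ((m 4 0 + 1) * (300 * (n + 4))) insertProg m fun m' =>
      AgreeOff [4, 10, 12, 13, 14] m m' ∧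
      ((m 11 0 = 0 ∨ entry n m (m 4 0) ∈ L) ∧ Stores m' L ∨
        m 11 0 ≠ 0 ∧ entry n m (m 4 0) ∉ L ∧ Stores m' (L ++ [entry n m (m 4 0)])) := by
  refine (HaltsIn.ite (T := (m 4 0 + 1) * (200 * (n + 4)) + 50) (fun h11 => ?_)
    (fun h11 => ?_)).mono ?_ fun _ h => h
  · refine .mono (.seq ((searchProg_spec hW hL).mono le_rfl ?_))
      (T := (m 4 0 + 1) * (200 * (n + 4)) + (Prog.ite (var 10) .skip
        (assign 4 (.add (var 4) (var 3)))).time)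
      (by simp [Prog.time, Exp.cost, var, assign]) fun _ h => h
    rintro m' ⟨h₁, h₂⟩
    refine .of_loopFree (by simp [assign, Prog.LoopFree]) ?_
    by_cases h10 : m' 10 0 = 0
    · have hmem : entry n m (m 4 0) ∉ L := by
        rw [← h₂]
        simpa using h10
      have hrun : (Prog.ite (var 10) .skip (assign 4 (.add (var 4) (var 3)))).run m' =
          m'.write 4 0 (L.length * (n + 3) + (n + 3)) := by
        simp [Prog.run, h10, assign, h₁ 4 (by simp), h₁ 3 (by simp), hW, hL.length]
      rw [hrun]
      refine ⟨?_, .inr ⟨h11, hmem, ⟨?_, ?_⟩⟩⟩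
      · intro a ha
        simp only [List.mem_cons, not_or] at ha
        rw [Mem.write_of_ne ha.1, h₁ a]
        simp [ha]
      · simp [Mem.write_apply, add_mul]
      · intro i hi
        have : entry n (m'.write 4 0 (L.length * (n + 3) + (n + 3))) (i * (n + 3)) =
            entry n m (i * (n + 3)) := by
          simp [entry, Mem.write_of_ne, h₁ 2]
        rw [this]
        by_cases hi' : i < L.length
        · rw [List.getElem_append_left hi']
          exact hL.entry i hi'
        · obtain rfl : i = L.length := by
            simp at hi
            omega
          simp [hL.length]
    · have hrun : (Prog.ite (var 10) .skip (assign 4 (.add (var 4) (var 3)))).run m' = m' := by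
        simp [Prog.run, h10]
      rw [hrun]
      refine ⟨fun a ha => h₁ a ?_, .inl ⟨.inr (h₂.1 h10), ?_, ?_⟩⟩
      · simp only [List.mem_cons, not_or] at ha
        simp [ha]
      · rw [h₁ 4 (by simp), hL.length]
      · intro i hi
        rw [← hL.entry i hi]
        simp only [entry, h₁ 2 (by simp)]
  · exact (HaltsIn.skip ⟨fun _ _ => rfl, .inl ⟨.inl h11, hL⟩⟩).mono (by omega) fun _ h => h
  · simp only [Exp.cost, var]
    nlinarith

theorem Stores.congr {n : ℕ} {m m' : Mem} {L : List (Entry n)} (h : Stores m L)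
    (h4 : m' 4 0 = m 4 0) (h2 : ∀ i < m 4 0, m' 2 i = m 2 i) : Stores m' L := by
  refine ⟨h4.trans h.length, fun i hi => ?_⟩
  rw [← h.entry i hi, entry_eq_iff]
  intro j hj
  refine h2 _ ?_
  rw [h.length]
  have : (i + 1) * (n + 3) ≤ L.length * (n + 3) := Nat.mul_le_mul_right _ hi
  rw [add_mul] at this
  omega

/-- The memory contains the input and a table of different entries from `S`. -/
structure Table {n : ℕ} (A : ℕ → ℕ) (S : Finset (Entry n)) (m : Mem) (L : List (Entry n)) :
    Prop where
  size : m 0 0 = n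
  adj : m 1 = A
  width : m 3 0 = n + 3
  stores : Stores m L
  nodup : L.Nodup
  subset : ∀ P ∈ L, P ∈ S

theorem Table.length_le {n : ℕ} {A : ℕ → ℕ} {S : Finset (Entry n)} {m : Mem} {L : List (Entry n)}
    (h : Table A S m L) : L.length ≤ S.card := by
  classical
  rw [← List.toFinset_card_of_nodup h.nodup]
  exact Finset.card_le_card fun P hP => h.subset P (List.mem_toFinset.1 hP)

theorem Table.end_le {n : ℕ} {A : ℕ → ℕ} {S : Finset (Entry n)} {m : Mem} {L : List (Entry n)}
    (h : Table A S m L) : m 4 0 ≤ S.card * (n + 3) := by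
  rw [h.stores.length]
  exact Nat.mul_le_mul_right _ h.length_le

theorem Table.congr {n : ℕ} {A : ℕ → ℕ} {S : Finset (Entry n)} {m m' : Mem} {L : List (Entry n)}
    (h : Table A S m L) {F : List ℕ} (hF : AgreeOff F m m')
    (hF' : ∀ a ∈ F, 5 ≤ a := by simp) : Table A S m' L := by
  have h' : ∀ a < 5, m' a = m a := fun a ha => hF a fun h => absurd (hF' a h) (by omega)
  refine ⟨?_, ?_, ?_, h.stores.congr ?_ ?_, h.nodup, h.subset⟩
  · rw [h' 0 (by omega), h.size]
  · rw [h' 1 (by omega), h.adj]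
  · rw [h' 3 (by omega), h.width]
  · rw [h' 4 (by omega)]
  · intros
    rw [h' 2 (by omega)]

theorem agreeOff_write (m : Mem) (a i x : ℕ) : AgreeOff [a] m (m.write a i x) := fun b hb =>
  Mem.write_of_ne (by simpa using hb)

/-- The table grows only at its end, so the position of an entry never changes. -/
theorem getElem?_eq_some_of_prefix {α : Type*} {L L' : List α} (h : L <+: L') {i : ℕ} {P : α}
    (hi : L[i]? = some P) : L'[i]? = some P := by
  obtain ⟨t, rfl⟩ := h
  obtain ⟨h, rfl⟩ := List.getElem?_eq_some_iff.1 hi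
  rw [List.getElem?_append_left h, List.getElem?_eq_getElem]

/-- Insert the combination of two entries into the table. -/
def tryProg (d : ℕ) (l : List ℕ) (x : ℕ) : Prog := .seq (combineProg d l x) insertProg

/-- A bound for the coefficient in the running time of `tryProg`. -/
def tryConst (d : ℕ) (l : List ℕ) (x : ℕ) : ℕ :=
  (headProg x).time + (digitProg d l x).time + 400

/-- The set `S` occurs only in the analysis: any set closed under combination that contains the
table bounds its length, and with it the time for the search. -/
theorem tryProg_spec {n d : ℕ} {A : ℕ → ℕ} {S : Finset (Entry n)} {l : List ℕ} {x : ℕ}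
    (hS : ∀ P ∈ S, ∀ Q ∈ S, P.Fits d A l x Q → P.combine d A x Q ∈ S)
    {m : Mem} {L : List (Entry n)} (h : Table A S m L) {i j : ℕ} {P Q : Entry n}
    (h7 : m 7 0 = i * (n + 3)) (h8 : m 8 0 = j * (n + 3)) (hP : L[i]? = some P)
    (hQ : L[j]? = some Q) :
    HaltsIn (tryConst d l x * ((S.card + 1) * (n + 4) ^ 2)) (tryProg d l x) m fun m' =>
      AgreeOff [2, 4, 10, 11, 12, 13, 14] m m' ∧ ∃ L', Table A S m' L' ∧ L <+: L' ∧
        (P.Fits d A l x Q → P.combine d A x Q ∈ L') := by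
  obtain ⟨hi, rfl⟩ := List.getElem?_eq_some_iff.1 hP
  obtain ⟨hj, rfl⟩ := List.getElem?_eq_some_iff.1 hQ
  have hle : ∀ k < L.length, k * (n + 3) + (n + 3) ≤ m 4 0 := by
    intro k hk
    rw [h.stores.length]
    have : (k + 1) * (n + 3) ≤ L.length * (n + 3) := Nat.mul_le_mul_right _ hk
    rwa [add_mul, one_mul] at this
  refine .mono (.seq ((combineProg_spec (d := d) (l := l) (x := x) h.size h.adj (h7 ▸ hle i hi)
    (h8 ▸ hle j hj)).mono le_rfl ?_)) (T := (headProg x).time +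
      (n + 1) * ((digitProg d l x).time + 6) + (m 4 0 + 1) * (300 * (n + 4))) ?_ fun _ h => h
  · rintro m' ⟨h₁, h₂, h₃, h₄⟩
    rw [h7, h8, h.stores.entry i hi, h.stores.entry j hj] at h₃ h₄
    have h4 : m' 4 0 = m 4 0 := by rw [h₁ 4 (by simp)]
    have hst : Stores m' L := h.stores.congr h4 h₂
    rw [← h4]
    refine (insertProg_spec (by rw [h₁ 3 (by simp), h.width]) hst).mono le_rfl ?_
    rw [h4, h₃]
    rintro m'' ⟨h₅, h₆⟩
    have h₇ : AgreeOff [2, 4, 10, 11, 12, 13, 14] m m'' := h₁.trans h₅ (by simp) (by simp)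
    refine ⟨h₇, ?_⟩
    have e0 : m'' 0 0 = n := by rw [h₇ 0 (by simp), h.size]
    have e1 : m'' 1 = A := by rw [h₇ 1 (by simp), h.adj]
    have e3 : m'' 3 0 = n + 3 := by rw [h₇ 3 (by simp), h.width]
    rcases h₆ with ⟨h₆, h₈⟩ | ⟨h₆, h₈, h₉⟩
    · refine ⟨L, ⟨e0, e1, e3, h₈, h.nodup, h.subset⟩, List.prefix_rfl, fun hf => ?_⟩
      exact h₆.resolve_left (h₄.2 hf)
    · refine ⟨_, ⟨e0, e1, e3, h₉, ?_, ?_⟩, List.prefix_append _ _, fun _ => by simp⟩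
      · rw [List.nodup_append]
        refine ⟨h.nodup, by simp, ?_⟩
        intro a ha b hb
        rw [List.mem_singleton] at hb
        rintro rfl
        exact h₈ (hb ▸ ha)
      · intro R hR
        rcases List.mem_append.1 hR with hR | hR
        · exact h.subset R hR
        · rw [List.mem_singleton.1 hR]
          exact hS _ (h.subset _ (List.getElem_mem _)) _ (h.subset _ (List.getElem_mem _)) (h₄.1 h₆)
  · have h₁ := h.end_le
    set M := S.card
    set a := (headProg x).time
    set b := (digitProg d l x).time
    have h₂ : 1 ≤ (M + 1) * (n + 4) ^ 2 := Nat.one_le_iff_ne_zero.2 (by positivity)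
    have h₃ : n + 1 ≤ (M + 1) * (n + 4) ^ 2 := by nlinarith [Nat.zero_le (M * (n + 4) ^ 2)]
    have h₄ : (m 4 0 + 1) * (n + 4) ≤ (M + 1) * (n + 4) ^ 2 := by
      rw [pow_two, ← mul_assoc]
      refine Nat.mul_le_mul_right _ ?_
      nlinarith
    calc _ = a * 1 + b * (n + 1) + 6 * (n + 1) + 300 * ((m 4 0 + 1) * (n + 4)) := by ring
      _ ≤ a * ((M + 1) * (n + 4) ^ 2) + b * ((M + 1) * (n + 4) ^ 2) +
          6 * ((M + 1) * (n + 4) ^ 2) + 300 * ((M + 1) * (n + 4) ^ 2) := by gcongr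
      _ ≤ (a + b + 400) * ((M + 1) * (n + 4) ^ 2) := by
        rw [← add_mul, ← add_mul, ← add_mul]
        exact Nat.mul_le_mul_right _ (by omega)

/-! ### Closing the table under combination. -/

/-- Insert both combinations of the entries that the variables `a` and `b` point to. -/
def pairProg (d : ℕ) (τ : ℕ → List ℕ) (a b : ℕ) : Prog :=
  block [assign 7 (var a), assign 8 (var b), tryProg d (τ 0) 0, tryProg d (τ 1) 1]

/-- `L` contains all combinations of `P` and `Q`. -/
def Done {n : ℕ} (d : ℕ) (A : ℕ → ℕ) (τ : ℕ → List ℕ) (L : List (Entry n)) (P Q : Entry n) : Prop :=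
  ∀ x < 2, P.Fits d A (τ x) x Q → P.combine d A x Q ∈ L

theorem Done.mono {n d : ℕ} {A : ℕ → ℕ} {τ : ℕ → List ℕ} {L L' : List (Entry n)} {P Q : Entry n}
    (h : Done d A τ L P Q) (h' : L <+: L') : Done d A τ L' P Q :=
  fun x hx hf => h'.subset (h x hx hf)

/-- `S` contains all combinations of its elements. -/
def Closed {n : ℕ} (d : ℕ) (A : ℕ → ℕ) (τ : ℕ → List ℕ) (S : Finset (Entry n)) : Prop :=
  ∀ x < 2, ∀ P ∈ S, ∀ Q ∈ S, P.Fits d A (τ x) x Q → P.combine d A x Q ∈ S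

/-- A bound for the coefficient in the running time of `pairProg`. -/
def pairConst (d : ℕ) (τ : ℕ → List ℕ) : ℕ := tryConst d (τ 0) 0 + tryConst d (τ 1) 1 + 10

theorem pairProg_spec {n d : ℕ} {A : ℕ → ℕ} {S : Finset (Entry n)} {τ : ℕ → List ℕ}
    (hS : Closed d A τ S) {m : Mem} {L : List (Entry n)} (h : Table A S m L) {a b i j : ℕ}
    {P Q : Entry n} (hb7 : b ≠ 7)
    (ha : m a 0 = i * (n + 3)) (hb : m b 0 = j * (n + 3)) (hP : L[i]? = some P)
    (hQ : L[j]? = some Q) :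
    HaltsIn (pairConst d τ * ((S.card + 1) * (n + 4) ^ 2)) (pairProg d τ a b) m fun m' =>
      AgreeOff [2, 4, 7, 8, 10, 11, 12, 13, 14] m m' ∧ ∃ L', Table A S m' L' ∧ L <+: L' ∧
        Done d A τ L' P Q := by
  set m₁ := (m.write 7 0 (m a 0)).write 8 0 (m b 0) with hm₁
  have hF : AgreeOff [7, 8] m m₁ :=
    (agreeOff_write m 7 0 _).trans (agreeOff_write _ 8 0 _) (by simp) (by simp)
  have h₁ : Table A S m₁ L := h.congr hF
  have h7 : m₁ 7 0 = i * (n + 3) := by simp [hm₁, Mem.write_apply, ha]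
  have h8 : m₁ 8 0 = j * (n + 3) := by simp [hm₁, Mem.write_apply, hb]
  refine HaltsIn.mono (T := (var a).cost + 2 + ((var b).cost + 2 +
    (tryConst d (τ 0) 0 * ((S.card + 1) * (n + 4) ^ 2) +
      (tryConst d (τ 1) 1 * ((S.card + 1) * (n + 4) ^ 2) + 1))))
    (.seq (.assign (.seq (.assign ?_)))) ?_ fun _ h => h
  · simp only [eval_var, Mem.write_of_ne hb7]
    refine .seq ((tryProg_spec (hS 0 (by omega)) h₁ h7 h8 hP hQ).mono le_rfl ?_)
    rintro m₂ ⟨hF₂, L₂, h₂, hL₂, hd₂⟩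
    refine .seq ((tryProg_spec (hS 1 (by omega)) h₂ (i := i) (j := j) ?_ ?_
      (getElem?_eq_some_of_prefix hL₂ hP) (getElem?_eq_some_of_prefix hL₂ hQ)).mono le_rfl ?_)
    · rw [hF₂ 7 (by simp), h7]
    · rw [hF₂ 8 (by simp), h8]
    · rintro m₃ ⟨hF₃, L₃, h₃, hL₃, hd₃⟩
      refine .skip ⟨hF.trans (hF₂.trans hF₃ (List.Subset.refl _) (List.Subset.refl _)) (by simp)
        (by simp), L₃, h₃, hL₂.trans hL₃, fun x hx hf => ?_⟩
      interval_cases x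
      · exact hL₃.subset (hd₂ hf)
      · exact hd₃ hf
  · have h₂ : 1 ≤ (S.card + 1) * (n + 4) ^ 2 := Nat.one_le_iff_ne_zero.2 (by positivity)
    simp only [Exp.cost, var]
    generalize (S.card + 1) * (n + 4) ^ 2 = N at h₂ ⊢
    rw [pairConst, add_mul, add_mul]
    omega

/-- Combine the entry that variable `5` points to with all entries up to this one. -/
def rowProg (d : ℕ) (τ : ℕ → List ℕ) : Prog :=
  block [assign 6 (.lit 0),
    .loop (.sub (.add (var 5) (var 3)) (var 6))
      (block [pairProg d τ 5 6, pairProg d τ 6 5, assign 6 (.add (var 6) (var 3))])]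

/-- A pair of entries is treated, in both orders, in the row of the one with the larger index.
Entries appended during row `k` have index above `k` and wait for their own rows. -/
theorem rowProg_spec {n d : ℕ} {A : ℕ → ℕ} {S : Finset (Entry n)} {τ : ℕ → List ℕ}
    (hS : Closed d A τ S) {m : Mem} {L : List (Entry n)} (h : Table A S m L) {k : ℕ}
    {P : Entry n} (hk : m 5 0 = k * (n + 3)) (hP : L[k]? = some P) :
    HaltsIn (8 * pairConst d τ * ((S.card + 1) ^ 2 * (n + 4) ^ 3)) (rowProg d τ) m fun m' =>
      AgreeOff [2, 4, 6, 7, 8, 10, 11, 12, 13, 14] m m' ∧ ∃ L', Table A S m' L' ∧ L <+: L' ∧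
        ∀ i ≤ k, ∀ Q, L'[i]? = some Q → Done d A τ L' P Q ∧ Done d A τ L' Q P := by
  have hkl : k < L.length := (List.getElem?_eq_some_iff.1 hP).1
  have hkM : (k + 1) * (n + 3) ≤ S.card * (n + 3) :=
    Nat.mul_le_mul_right _ (hkl.trans_le h.length_le)
  set T := pairConst d τ * ((S.card + 1) * (n + 4) ^ 2) with hT
  have key := HaltsIn.loop (T := T + (T + 8)) (e := .sub (.add (var 5) (var 3)) (var 6))
    (P := block [pairProg d τ 5 6, pairProg d τ 6 5, assign 6 (.add (var 6) (var 3))])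
    (fun m' => AgreeOff [2, 4, 6, 7, 8, 10, 11, 12, 13, 14] m m' ∧ ∃ L', Table A S m' L' ∧ L <+: L' ∧
      ∃ j ≤ k + 1, m' 6 0 = j * (n + 3) ∧
        ∀ i < j, ∀ Q, L'[i]? = some Q → Done d A τ L' P Q ∧ Done d A τ L' Q P)
    (fun m' => (k + 1) * (n + 3) - m' 6 0) (fun m' hI he => ?_) (m := m.write 6 0 0) ?_
  · have h : HaltsIn _ (rowProg d τ) m _ := .seq (.assign (.seq (key.mono le_rfl
      fun m' hI => .skip hI)))
    refine h.mono ?_ ?_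
    · have h₁ : 1 ≤ (S.card + 1) * (n + 4) ^ 2 := Nat.one_le_iff_ne_zero.2 (by positivity)
      have h₂ : 10 ≤ pairConst d τ := by simp [pairConst]
      have h₃ : 10 ≤ T := h₂.trans (Nat.le_mul_of_pos_right _ h₁)
      have h₄ : (k + 1) * (n + 3) + 1 ≤ (S.card + 1) * (n + 4) := by nlinarith
      have h₅ : 1 ≤ (S.card + 1) * (n + 4) := Nat.one_le_iff_ne_zero.2 (by positivity)
      simp only [Exp.cost, var, Mem.write_apply]
      norm_num
      calc _ ≤ ((k + 1) * (n + 3) + 1) * (4 * T) + T := by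
            have : T + (T + 8) + 8 + 1 ≤ 4 * T := by omega
            have := Nat.mul_le_mul_left ((k + 1) * (n + 3) + 1) this
            omega
        _ ≤ ((S.card + 1) * (n + 4)) * (4 * T) + ((S.card + 1) * (n + 4)) * T := by
            gcongr
            exact Nat.le_mul_of_pos_left _ h₅
        _ ≤ ((S.card + 1) * (n + 4)) * (8 * T) := by
            rw [← mul_add]
            exact Nat.mul_le_mul_left _ (by omega)
        _ = _ := by rw [hT]; ring
    · rintro m' ⟨⟨h₁, L', h₂, hL', j, hj, h₃, h₄⟩, h₅⟩
      refine ⟨h₁, L', h₂, hL', fun i hi => h₄ i ?_⟩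
      simp only [eval_sub, eval_add, eval_var, h₁ 5 (by simp), h₂.width, hk, h₃] at h₅
      have : k + 1 ≤ j := by
        refine Nat.le_of_mul_le_mul_right (c := n + 3) ?_ (by omega)
        rw [add_mul]
        omega
      omega
  · obtain ⟨h₁, L₁, h₂, hL₁, j, hj, h₃, h₄⟩ := hI
    simp only [eval_sub, eval_add, eval_var, h₁ 5 (by simp), h₂.width, hk, h₃] at he
    have hjk : j < k + 1 := by
      by_contra hc
      have := Nat.mul_le_mul_right (n + 3) (not_lt.1 hc)
      rw [add_mul] at this
      omega
    have hjl : j < L₁.length := by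
      have := hL₁.length_le
      omega
    have hQ : L₁[j]? = some L₁[j] := List.getElem?_eq_getElem hjl
    have hP₁ := getElem?_eq_some_of_prefix hL₁ hP
    have h5 : m' 5 0 = k * (n + 3) := by rw [h₁ 5 (by simp), hk]
    refine .seq ((pairProg_spec hS h₂ (by omega) h5 h₃ hP₁ hQ).mono le_rfl ?_)
    rintro m₂ ⟨hF₂, L₂, h₅, hL₂, hd₂⟩
    have h5' : m₂ 5 0 = k * (n + 3) := by rw [hF₂ 5 (by simp), h5]
    have h6' : m₂ 6 0 = j * (n + 3) := by rw [hF₂ 6 (by simp), h₃]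
    refine .mono (.seq ((pairProg_spec hS h₅ (by omega) h6' h5' (getElem?_eq_some_of_prefix hL₂ hQ)
      (getElem?_eq_some_of_prefix hL₂ hP₁)).mono le_rfl ?_)) (T := T + 8) (by omega) fun _ h => h
    rintro m₃ ⟨hF₃, L₃, h₆, hL₃, hd₃⟩
    have h6'' : m₃ 6 0 = j * (n + 3) := by rw [hF₃ 6 (by simp), h6']
    refine .mono (.seq (.assign (.skip ?_))) (T' := 8) (by simp [Exp.cost, var]) fun _ h => h
    have hrun : m₃.write 6 0 ((Exp.add (var 6) (var 3)).eval m₃) =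
        m₃.write 6 0 ((j + 1) * (n + 3)) := by simp [h6'', h₆.width, add_mul]
    rw [hrun]
    have hF : AgreeOff [2, 4, 6, 7, 8, 10, 11, 12, 13, 14] m₂ m₃ := fun a ha =>
      hF₃ a fun h => ha (by simp at h ⊢; omega)
    have hF' : AgreeOff [2, 4, 6, 7, 8, 10, 11, 12, 13, 14] m' m₂ := fun a ha =>
      hF₂ a fun h => ha (by simp at h ⊢; omega)
    refine ⟨⟨?_, L₃, h₆.congr (agreeOff_write _ _ _ _), hL₁.trans (hL₂.trans hL₃), j + 1, hjk, ?_,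
      fun i hi R hR => ?_⟩, ?_⟩
    · exact h₁.trans (hF'.trans (hF.trans (agreeOff_write _ _ _ _) (List.Subset.refl _) (by simp))
        (List.Subset.refl _) (List.Subset.refl _)) (List.Subset.refl _) (List.Subset.refl _)
    · simp [Mem.write_apply]
    · rcases Nat.lt_succ_iff_lt_or_eq.1 hi with hi | rfl
      · have hi' : i < L₁.length := by omega
        have hR' : L₁[i]? = some R := by
          rw [List.getElem?_eq_getElem hi', ← hR]
          exact (getElem?_eq_some_of_prefix (hL₂.trans hL₃) (List.getElem?_eq_getElem hi')).symm
        obtain ⟨h₇, h₈⟩ := h₄ i hi R hR'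
        exact ⟨h₇.mono (hL₂.trans hL₃), h₈.mono (hL₂.trans hL₃)⟩
      · have := getElem?_eq_some_of_prefix (hL₂.trans hL₃) hQ
        rw [hR, Option.some_inj] at this
        rw [this]
        exact ⟨hd₂.mono hL₃, hd₃⟩
    · have h6 : m₃.write 6 0 ((j + 1) * (n + 3)) 6 0 = (j + 1) * (n + 3) := by
        simp [Mem.write_apply]
      have h₇ : (j + 1) * (n + 3) ≤ (k + 1) * (n + 3) := Nat.mul_le_mul_right _ hjk
      have h₈ : (j + 1) * (n + 3) = j * (n + 3) + (n + 3) := by ring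
      rw [h6, h₃]
      omega
  · refine ⟨fun a ha => (agreeOff_write m 6 0 0) a ?_, L, h.congr (agreeOff_write m 6 0 0),
      List.prefix_rfl, 0, by omega, by simp [Mem.write_apply], by simp⟩
    simp only [List.mem_cons, not_or] at ha
    simp [ha]

end RAM

/-! ### Codes of optima, and the complete program. -/

/-- `out` encodes the optimum of `F`, or that `F` is empty. -/
def IsOptimumCode (goal : Goal) (F : Set ℕ) (out : ℕ) : Prop :=
  (F = ∅ ∧ out = 0) ∨ ∃ s, goal.IsOptimum F s ∧ out = s + 1

theorem IsOptimumCode.insert_maximum {F : Set ℕ} {out : ℕ} (h : IsOptimumCode .maximum F out)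
    (s : ℕ) : IsOptimumCode .maximum (insert s F) (out + (s + 1 - out)) := by
  right
  rcases h with ⟨rfl, rfl⟩ | ⟨t, ht, rfl⟩
  · exact ⟨s, by simp [Goal.IsOptimum], by omega⟩
  · exact ⟨max s t, IsGreatest.insert s ht, by omega⟩

/-- For the maximum, the code `0` of the empty set is neutral. For the minimum it would always win,
hence the case distinction. -/
theorem IsOptimumCode.insert_minimum {F : Set ℕ} {out : ℕ} (h : IsOptimumCode .minimum F out)
    (s : ℕ) : IsOptimumCode .minimum (insert s F)
      (if out = 0 then s + 1 else out - (out - (s + 1))) := by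
  right
  rcases h with ⟨rfl, rfl⟩ | ⟨t, ht, rfl⟩
  · exact ⟨s, by simp [Goal.IsOptimum], by simp⟩
  · refine ⟨min s t, IsLeast.insert s ht, ?_⟩
    rw [if_neg (by omega)]
    omega

namespace RAM

/-- Create the two entries that the others are combined from. -/
def initProg : Prog :=
  block [assign 3 (.add (var 0) (.lit 3)), .set 2 (.lit 1) (var 0), .set 2 (var 3) (.lit 1),
    assign 4 (.add (var 3) (var 3)), assign 5 (.lit 0)]

/-- Form all combinations of entries. -/
def closeProg (d : ℕ) (τ : ℕ → List ℕ) : Prog :=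
  .loop (.sub (var 4) (var 5)) (.seq (rowProg d τ) (assign 5 (.add (var 5) (var 3))))

/-- The initial entries. -/
def initialEntries (n : ℕ) : List (Entry n) := [⟨0, n, 0, 0⟩, ⟨1, 0, 0, 0⟩]

theorem initProg_spec {n : ℕ} {A : ℕ → ℕ} {S : Finset (Entry n)} {m : Mem} (h0 : m 0 0 = n)
    (h1 : m 1 = A) (h2 : ∀ i, m 2 i = 0) (hS : ∀ P ∈ initialEntries n, P ∈ S) :
    HaltsIn 40 initProg m fun m' => Table A S m' (initialEntries n) ∧ m' 5 0 = 0 := by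
  refine (HaltsIn.of_loopFree (by simp [initProg, block, assign, Prog.LoopFree])
    (Q := fun m' => Table A S m' (initialEntries n) ∧ m' 5 0 = 0) ?_).mono
    (by simp [initProg, block, assign, Prog.time, Exp.cost, var]) fun _ h => h
  have hrun : initProg.run m = ((((m.write 3 0 (n + 3)).write 2 1 n).write 2 (n + 3) 1).write 4 0
      (n + 3 + (n + 3))).write 5 0 0 := by
    simp [initProg, block, assign, Prog.run, Mem.write_apply, h0]
  rw [hrun]
  refine ⟨⟨?_, ?_, ?_, ⟨?_, ?_⟩, ?_, hS⟩, ?_⟩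
  · simp [Mem.write_apply, h0]
  · simp [Mem.write_of_ne, h1]
  · simp [Mem.write_apply]
  · simp [Mem.write_apply, initialEntries, two_mul]
  · intro i hi
    have : i = 0 ∨ i = 1 := by
      simp [initialEntries] at hi
      omega
    rcases this with rfl | rfl
    · refine Entry.ext ?_ ?_ ?_ (funext fun u => ?_)
      · simp [entry, initialEntries, Mem.write_apply, h2]
      · simp [entry, initialEntries, Mem.write_apply]
      · simp [entry, initialEntries, Mem.write_apply, h2]
      · have h₁ : 0 * (n + 3) + 3 + (u : ℕ) ≠ 1 := by omega
        have h₂ : 0 * (n + 3) + 3 + (u : ℕ) ≠ n + 3 := by omega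
        simp only [entry, initialEntries, Mem.write_apply, h₁, h₂]
        simp [h2]
    · refine Entry.ext ?_ ?_ ?_ (funext fun u => ?_)
      · simp [entry, initialEntries, Mem.write_apply]
      · simp [entry, initialEntries, Mem.write_apply, h2]
      · simp [entry, initialEntries, Mem.write_apply, h2]
      · have h₁ : 1 * (n + 3) + 3 + (u : ℕ) ≠ 1 := by omega
        have h₂ : 1 * (n + 3) + 3 + (u : ℕ) ≠ n + 3 := by omega
        simp only [entry, initialEntries, Mem.write_apply, h₁, h₂]
        simp [h2]
  · simp [initialEntries]
  · simp [Mem.write_apply]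

/-- The table grows while it is traversed, but its entries are distinct elements of `S`, so the
pointer never passes `S.card * (n + 3)`. Rows, partners and search each contribute a factor `(S.card
+ 1) * (n + 4)`, since loops are counted in cells instead of entries; one comparison contributes the
fourth factor `n + 4`. -/
theorem closeProg_spec {n d : ℕ} {A : ℕ → ℕ} {S : Finset (Entry n)} {τ : ℕ → List ℕ}
    (hS : Closed d A τ S) {m : Mem} {L₀ : List (Entry n)} (h : Table A S m L₀) (h5 : m 5 0 = 0) :
    HaltsIn (9 * pairConst d τ * ((S.card + 1) ^ 3 * (n + 4) ^ 4)) (closeProg d τ) m fun m' =>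
      ∃ L, Table A S m' L ∧ L₀ <+: L ∧ ∀ P ∈ L, ∀ Q ∈ L, Done d A τ L P Q := by
  set T := 8 * pairConst d τ * ((S.card + 1) ^ 2 * (n + 4) ^ 3) with hT
  have key := HaltsIn.loop (T := T + 7) (e := .sub (var 4) (var 5))
    (P := .seq (rowProg d τ) (assign 5 (.add (var 5) (var 3))))
    (fun m' => ∃ L, Table A S m' L ∧ L₀ <+: L ∧ ∃ k ≤ L.length, m' 5 0 = k * (n + 3) ∧
      ∀ i < k, ∀ j < k, ∀ P Q, L[i]? = some P → L[j]? = some Q → Done d A τ L P Q)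
    (fun m' => S.card * (n + 3) - m' 5 0) (fun m' hI he => ?_) (m := m) ?_
  · refine key.mono ?_ ?_
    · have h₁ : 1 ≤ (S.card + 1) ^ 2 * (n + 4) ^ 3 := Nat.one_le_iff_ne_zero.2 (by positivity)
      have h₂ : 13 ≤ pairConst d τ * ((S.card + 1) ^ 2 * (n + 4) ^ 3) := by
        have : 13 ≤ pairConst d τ := by
          simp only [pairConst, tryConst]
          omega
        exact this.trans (Nat.le_mul_of_pos_right _ h₁)
      calc _ ≤ ((S.card + 1) * (n + 4)) *
            (9 * (pairConst d τ * ((S.card + 1) ^ 2 * (n + 4) ^ 3))) := by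
            refine Nat.mul_le_mul ?_ ?_
            · have : S.card * (n + 3) + 1 ≤ (S.card + 1) * (n + 4) := by nlinarith
              omega
            · simp only [Exp.cost, var, hT]
              rw [mul_assoc 8]
              omega
        _ = _ := by ring
    · rintro m' ⟨⟨L, h₁, hL, k, hk, h₂, h₃⟩, h₄⟩
      refine ⟨L, h₁, hL, fun P hP Q hQ => ?_⟩
      simp only [eval_sub, eval_var, h₁.stores.length, h₂] at h₄
      have hk' : L.length ≤ k :=
        Nat.le_of_mul_le_mul_right (c := n + 3) (Nat.le_of_sub_eq_zero h₄) (by omega)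
      obtain ⟨i, hi, rfl⟩ := List.getElem_of_mem hP
      obtain ⟨j, hj, rfl⟩ := List.getElem_of_mem hQ
      exact h₃ i (by omega) j (by omega) _ _ (List.getElem?_eq_getElem hi)
        (List.getElem?_eq_getElem hj)
  · obtain ⟨L, h₁, hL, k, hk, h₂, h₃⟩ := hI
    have hk' : k < L.length := by
      simp only [eval_sub, eval_var, h₁.stores.length, h₂] at he
      by_contra hc
      exact he (Nat.sub_eq_zero_of_le (Nat.mul_le_mul_right _ (not_lt.1 hc)))
    have hP : L[k]? = some L[k] := List.getElem?_eq_getElem hk'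
    refine .seq ((rowProg_spec hS h₁ h₂ hP).mono le_rfl ?_)
    rintro m₂ ⟨hF, L', h₄, hL', h₅⟩
    refine .mono (.assign ?_) (T := 7) le_rfl fun _ h => h
    have hrun : m₂.write 5 0 ((Exp.add (var 5) (var 3)).eval m₂) =
        m₂.write 5 0 ((k + 1) * (n + 3)) := by simp [h₄.width, hF 5, h₂, add_mul]
    have hkl := hL'.length_le
    rw [hrun]
    have h5' : m₂.write 5 0 ((k + 1) * (n + 3)) 5 0 = (k + 1) * (n + 3) := by
      simp [Mem.write_apply]
    refine ⟨⟨L', h₄.congr (agreeOff_write _ _ _ _), hL.trans hL', k + 1, by omega, h5', ?_⟩, ?_⟩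
    · intro i hi j hj P Q hP' hQ'
      have hPk := getElem?_eq_some_of_prefix hL' hP
      rcases Nat.lt_succ_iff_lt_or_eq.1 hi with hi | rfl
      · rcases Nat.lt_succ_iff_lt_or_eq.1 hj with hj | rfl
        · have old : ∀ i < k, ∀ P, L'[i]? = some P → L[i]? = some P := by
            intro i hi P hP'
            have hi' : i < L.length := by omega
            rw [List.getElem?_eq_getElem hi', ← hP']
            exact (getElem?_eq_some_of_prefix hL' (List.getElem?_eq_getElem hi')).symm
          exact (h₃ i hi j hj P Q (old i hi P hP') (old j hj Q hQ')).mono hL'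
        · rw [hQ', Option.some_inj] at hPk
          rw [hPk]
          exact (h₅ i hi.le P hP').2
      · rw [hP', Option.some_inj] at hPk
        rw [hPk]
        exact (h₅ j (by omega) Q hQ').1
    · have h₆ : (k + 1) * (n + 3) ≤ S.card * (n + 3) :=
        Nat.mul_le_mul_right _ (hk'.trans_le h₁.length_le)
      have h₇ : (k + 1) * (n + 3) = k * (n + 3) + (n + 3) := by ring
      rw [h5', h₂]
      omega
  · exact ⟨L₀, h, List.prefix_rfl, 0, by omega, by simpa using h5, by simp⟩

/-- Improve the optimum found so far by the value of the current entry. -/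
def updateProg : Goal → Prog
  | .maximum => assign 10 (.add (var 10)
      (.sub (.add (.get 2 (.add (var 5) (.lit 2))) (.lit 1)) (var 10)))
  | .minimum => .ite (var 10)
      (assign 10 (.sub (var 10) (.sub (var 10) (.add (.get 2 (.add (var 5) (.lit 2))) (.lit 1)))))
      (assign 10 (.add (.get 2 (.add (var 5) (.lit 2))) (.lit 1)))

theorem updateProg_spec {goal : Goal} {m : Mem} {F : Set ℕ} (h : IsOptimumCode goal F (m 10 0)) :
    HaltsIn 20 (updateProg goal) m fun m' => AgreeOff [10] m m' ∧
      IsOptimumCode goal (insert (m 2 (m 5 0 + 2)) F) (m' 10 0) := by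
  cases goal with
  | maximum =>
    refine .mono (.assign ⟨agreeOff_write _ _ _ _, ?_⟩) (by simp [Exp.cost, var]) fun _ h => h
    simpa [Mem.write_apply] using h.insert_maximum _
  | minimum =>
    have := h.insert_minimum (m 2 (m 5 0 + 2))
    refine (HaltsIn.ite (fun h => ?_) (fun h => ?_) (T := 16)).mono (by simp [Exp.cost, var])
      fun _ h => h
    · refine .mono (.assign ⟨agreeOff_write _ _ _ _, ?_⟩) (by simp [Exp.cost, var]) fun _ h => h
      rw [eval_var] at h
      simpa [Mem.write_apply, h] using this
    · refine .mono (.assign ⟨agreeOff_write _ _ _ _, ?_⟩) (by simp [Exp.cost, var]) fun _ h => h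
      rw [eval_var] at h
      simpa [Mem.write_apply, h] using this

/-- Determine the optimum value of an entry for a solution of the whole problem. -/
def scanProg (goal : Goal) : Prog :=
  block [assign 10 (.lit 0), assign 5 (.lit 0),
    .loop (.sub (var 4) (var 5))
      (.seq (.ite (.get 2 (var 5)) (.ite (dist (.get 2 (.add (var 5) (.lit 1))) (var 0)) .skip
        (updateProg goal)) .skip) (assign 5 (.add (var 5) (var 3)))),
    assign 0 (var 10)]

theorem scanProg_spec {n : ℕ} {A : ℕ → ℕ} {S : Finset (Entry n)} {goal : Goal} {m : Mem}
    {L : List (Entry n)} (h : Table A S m L) :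
    HaltsIn (100 * ((S.card + 1) * (n + 4))) (scanProg goal) m fun m' =>
      IsOptimumCode goal {s | ∃ P ∈ L, P.kind ≠ 0 ∧ P.level = n ∧ P.val = s} (m' 0 0) := by
  have key := HaltsIn.loop (T := 55) (e := .sub (var 4) (var 5))
    (P := .seq (.ite (.get 2 (var 5)) (.ite (dist (.get 2 (.add (var 5) (.lit 1))) (var 0)) .skip
        (updateProg goal)) .skip) (assign 5 (.add (var 5) (var 3))))
    (fun m' => AgreeOff [5, 10] m m' ∧ ∃ k ≤ L.length, m' 5 0 = k * (n + 3) ∧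
      IsOptimumCode goal {s | ∃ i < k, ∃ P, L[i]? = some P ∧ P.kind ≠ 0 ∧ P.level = n ∧ P.val = s}
        (m' 10 0))
    (fun m' => m 4 0 - m' 5 0) (fun m' hI he => ?_) (m := (m.write 10 0 0).write 5 0 0) ?_
  · have hfin : ∀ m', (AgreeOff [5, 10] m m' ∧ ∃ k ≤ L.length, m' 5 0 = k * (n + 3) ∧
        IsOptimumCode goal {s | ∃ i < k, ∃ P, L[i]? = some P ∧ P.kind ≠ 0 ∧ P.level = n ∧
          P.val = s} (m' 10 0)) ∧ (Exp.sub (var 4) (var 5)).eval m' = 0 →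
        IsOptimumCode goal {s | ∃ P ∈ L, P.kind ≠ 0 ∧ P.level = n ∧ P.val = s}
          (m'.write 0 0 ((var 10).eval m') 0 0) := by
      rintro m' ⟨⟨h₁, k, hk, h₂, h₃⟩, h₄⟩
      simp only [eval_sub, eval_var, h₁ 4 (by simp), h.stores.length, h₂] at h₄
      have hk' : L.length ≤ k :=
        Nat.le_of_mul_le_mul_right (c := n + 3) (Nat.le_of_sub_eq_zero h₄) (by omega)
      convert h₃ using 1
      · ext s
        constructor
        · rintro ⟨P, hP, h₅⟩
          obtain ⟨i, hi, rfl⟩ := List.getElem_of_mem hP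
          exact ⟨i, by omega, _, List.getElem?_eq_getElem hi, h₅⟩
        · rintro ⟨i, -, P, hP, h₅⟩
          exact ⟨P, List.mem_of_getElem? hP, h₅⟩
      · simp [Mem.write_apply]
    have hh : HaltsIn _ (scanProg goal) m (fun m' => IsOptimumCode goal
      {s | ∃ P ∈ L, P.kind ≠ 0 ∧ P.level = n ∧ P.val = s} (m' 0 0)) := .seq (.assign (.seq (.assign (.seq (key.mono le_rfl
      fun m' hI => .seq (.assign (.skip (hfin m' hI))))))))
    refine hh.mono ?_ fun _ h => h
    have := h.end_le
    simp only [Exp.cost, var, Mem.write_apply]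
    norm_num
    nlinarith
  · obtain ⟨h₁, k, hk, h₂, h₃⟩ := hI
    have hT : Table A S m' L := h.congr h₁
    have hk' : k < L.length := by
      simp only [eval_sub, eval_var, hT.stores.length, h₂] at he
      by_contra hc
      exact he (Nat.sub_eq_zero_of_le (Nat.mul_le_mul_right _ (not_lt.1 hc)))
    have hP := hT.stores.entry k hk'
    have hset : ∀ m'' : Mem, AgreeOff [10] m' m'' →
        IsOptimumCode goal {s | ∃ i < k + 1, ∃ P, L[i]? = some P ∧ P.kind ≠ 0 ∧ P.level = n ∧
          P.val = s} (m'' 10 0) →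
        HaltsIn 7 (assign 5 (.add (var 5) (var 3))) m'' fun m₃ => (AgreeOff [5, 10] m m₃ ∧
          ∃ k ≤ L.length, m₃ 5 0 = k * (n + 3) ∧ IsOptimumCode goal {s | ∃ i < k, ∃ P,
            L[i]? = some P ∧ P.kind ≠ 0 ∧ P.level = n ∧ P.val = s} (m₃ 10 0)) ∧
          m 4 0 - m₃ 5 0 < m 4 0 - m' 5 0 := by
      intro m'' hF hO
      have hT' : Table A S m'' L := hT.congr hF
      have h5 : m''.write 5 0 ((Exp.add (var 5) (var 3)).eval m'') 5 0 = (k + 1) * (n + 3) := by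
        simp [Mem.write_apply, hT'.width, hF 5, h₂, add_mul]
      refine .mono (.assign ⟨⟨?_, k + 1, hk', h5, ?_⟩, ?_⟩) le_rfl fun _ h => h
      · exact h₁.trans (hF.trans (agreeOff_write _ _ _ _) (S'' := [5, 10]) (by simp) (by simp))
          (List.Subset.refl _) (List.Subset.refl _)
      · simpa [Mem.write_apply] using hO
      · have h₆ : (k + 1) * (n + 3) ≤ L.length * (n + 3) := Nat.mul_le_mul_right _ hk'
        have h₇ : (k + 1) * (n + 3) = k * (n + 3) + (n + 3) := by ring
        rw [h5, h₂, h.stores.length]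
        omega
    have hold : (L[k].kind = 0 ∨ L[k].level ≠ n) →
        IsOptimumCode goal {s | ∃ i < k + 1, ∃ P, L[i]? = some P ∧ P.kind ≠ 0 ∧ P.level = n ∧
          P.val = s} (m' 10 0) := by
      intro hc
      convert h₃ using 3 with s
      constructor
      · rintro ⟨i, hi, P, hiP, h₄, h₅, h₆⟩
        rcases Nat.lt_succ_iff_lt_or_eq.1 hi with hi | rfl
        · exact ⟨i, hi, P, hiP, h₄, h₅, h₆⟩
        · rw [List.getElem?_eq_getElem hk', Option.some_inj] at hiP
          rw [hiP] at hc
          tauto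
      · rintro ⟨i, hi, h₄⟩
        exact ⟨i, by omega, h₄⟩
    refine .mono (T := 48 + 7) (.seq (T := 48) ?_) (by omega) fun _ h => h
    refine .mono (.ite (T := 40) (fun h₄ => .mono (.ite (T := 20) (fun h₅ => ?_) fun h₅ => ?_)
      ?_ fun _ h => h) fun h₄ => ?_) (by simp [Exp.cost, var]) fun _ h => h
    · refine .mono (.skip (hset m' (fun _ _ => rfl) (hold (.inr ?_)))) (by omega) fun _ h => h
      rw [Ne, eval_dist_eq_zero] at h₅
      rw [← hP]
      simpa [entry, ← h₂, hT.size] using h₅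
    · refine .mono (updateProg_spec h₃) le_rfl ?_
      rintro m'' ⟨h₆, h₇⟩
      refine hset m'' h₆ ?_
      convert h₇ using 1
      rw [eval_dist_eq_zero] at h₅
      have e₁ : L[k].kind ≠ 0 := by
        rw [← hP]
        simpa [entry, ← h₂] using h₄
      have e₂ : L[k].level = n := by
        rw [← hP]
        simpa [entry, ← h₂, hT.size] using h₅
      have e₃ : m' 2 (m' 5 0 + 2) = L[k].val := by
        rw [← hP]
        simp [entry, ← h₂]
      ext s
      rw [e₃, Set.mem_insert_iff]
      constructor
      · rintro ⟨i, hi, P, hiP, h₈⟩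
        rcases Nat.lt_succ_iff_lt_or_eq.1 hi with hi | rfl
        · exact .inr ⟨i, hi, P, hiP, h₈⟩
        · rw [List.getElem?_eq_getElem hk', Option.some_inj] at hiP
          rw [hiP]
          exact .inl h₈.2.2.symm
      · rintro (rfl | ⟨i, hi, h₈⟩)
        · exact ⟨k, by omega, L[k], List.getElem?_eq_getElem hk', e₁, e₂, rfl⟩
        · exact ⟨i, by omega, h₈⟩
    · simp [Exp.cost, var, dist]
    · refine .mono (.skip (hset m' (fun _ _ => rfl) (hold (.inl ?_)))) (by omega) fun _ h => h
      rw [← hP]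
      simpa [entry, ← h₂] using h₄
  · refine ⟨?_, 0, by omega, ?_, ?_⟩
    · exact (agreeOff_write m 10 0 0).trans (agreeOff_write _ 5 0 0) (by simp) (by simp)
    · simp [Mem.write_apply]
    · left
      simp [Mem.write_apply]

/-- The whole program. -/
def solveProg (goal : Goal) (d : ℕ) (τ : ℕ → List ℕ) : Prog :=
  .seq initProg (.seq (closeProg d τ) (scanProg goal))

/-- The final table is known only to contain the initial entries, to lie in `S` and to be closed.
This suffices: `S` gives soundness, closedness gives completeness. -/
theorem solveProg_spec {goal : Goal} {n d : ℕ} {A : ℕ → ℕ} {S : Finset (Entry n)}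
    {τ : ℕ → List ℕ} {m : Mem} (h0 : m 0 0 = n) (h1 : m 1 = A) (h2 : ∀ i, m 2 i = 0)
    (hS : Closed d A τ S) (hS' : ∀ P ∈ initialEntries n, P ∈ S) :
    HaltsIn ((9 * pairConst d τ + 140) * ((S.card + 1) ^ 3 * (n + 4) ^ 4)) (solveProg goal d τ) m
      fun m' => ∃ L : List (Entry n), (∀ P ∈ L, P ∈ S) ∧ (∀ P ∈ initialEntries n, P ∈ L) ∧
        (∀ P ∈ L, ∀ Q ∈ L, Done d A τ L P Q) ∧
        IsOptimumCode goal {s | ∃ P ∈ L, P.kind ≠ 0 ∧ P.level = n ∧ P.val = s} (m' 0 0) := by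
  refine .mono (.seq ((initProg_spec h0 h1 h2 hS').mono le_rfl ?_)) (T := 40 +
    (9 * pairConst d τ * ((S.card + 1) ^ 3 * (n + 4) ^ 4) + 100 * ((S.card + 1) * (n + 4))))
    ?_ fun _ h => h
  · rintro m₁ ⟨hT, h5⟩
    refine .seq ((closeProg_spec hS hT h5).mono le_rfl ?_)
    rintro m₂ ⟨L, hT', hL, hd⟩
    exact (scanProg_spec hT').mono le_rfl fun m' h => ⟨L, hT'.subset, fun P hP => hL.subset hP, hd, h⟩
  · have h₁ : (S.card + 1) * (n + 4) ≤ (S.card + 1) ^ 3 * (n + 4) ^ 4 :=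
      Nat.mul_le_mul (Nat.le_self_pow (by omega) _) (Nat.le_self_pow (by omega) _)
    have h₂ : 1 ≤ (S.card + 1) * (n + 4) := Nat.one_le_iff_ne_zero.2 (by positivity)
    generalize (S.card + 1) ^ 3 * (n + 4) ^ 4 = N at h₁ ⊢
    generalize (S.card + 1) * (n + 4) = K at h₁ h₂ ⊢
    rw [add_mul]
    omega

end RAM

/-! ## Truncated membership -/

/-- A finite set has no element from `dSet` on. A co-finite set reduces to this by complementation,
which does not change `dSet`. -/
theorem mem_iff_mem_of_dSet_le {μ : Set ℕ} (hμ : FinOrCofin μ) {a b : ℕ} (ha : dSet μ ≤ a)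
    (hb : dSet μ ≤ b) : a ∈ μ ↔ b ∈ μ := by
  have key : ∀ ν : Set ℕ, ν.Finite → ∀ c, dSet ν ≤ c → c ∉ ν := by
    intro ν hν c hc hcν
    obtain ⟨k, hk⟩ : ∃ k, IsGreatest ν k :=
      ⟨_, hν.isCompact.isGreatest_sSup ⟨c, hcν⟩⟩
    rw [dSet_of_isGreatest hk] at hc
    have := hk.2 hcν
    omega
  rcases hμ with h | h
  · simp [key μ h a ha, key μ h b hb]
  · have h₁ := key _ h a (by rwa [dSet_compl])
    have h₂ := key _ h b (by rwa [dSet_compl])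
    simp only [Set.mem_compl_iff, not_not] at h₁ h₂
    simp [h₁, h₂]

/-- This is what allows all counts to be truncated at `d`. -/
theorem min_mem_iff {μ : Set ℕ} (hμ : FinOrCofin μ) {d : ℕ} (hd : dSet μ ≤ d) (t : ℕ) :
    min d t ∈ μ ↔ t ∈ μ := by
  rcases le_total t d with h | h
  · rw [min_eq_right h]
  · rw [min_eq_left h]
    exact mem_iff_mem_of_dSet_le hμ hd (hd.trans h)

/-! ## The entries of a graph -/

namespace RAM

open Classical in
/-- `1` if `p` holds, and `0` otherwise. -/
noncomputable def indic (p : Prop) : ℕ := if p then 1 else 0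

theorem indic_of_not {p : Prop} (h : ¬ p) : indic p = 0 := if_neg h

open Classical in
/-- The number of neighbours of `u` in `Y`. -/
noncomputable def degIn {V : Type*} (G : SimpleGraph V) (Y : Finset V) (u : V) : ℕ :=
  (Y.filter fun w => G.Adj u w).card

/-- The vertices of `X` before `i`. -/
def low {n : ℕ} (i : ℕ) (X : Finset (Fin n)) : Finset (Fin n) := X.filter fun w => (w : ℕ) < i

/-- The vertices of `X` from `i` on. -/
def high {n : ℕ} (i : ℕ) (X : Finset (Fin n)) : Finset (Fin n) := X.filter fun w => i ≤ (w : ℕ)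

section degIn

variable {V : Type*} (G : SimpleGraph V)

@[simp] theorem degIn_empty (u : V) : degIn G ∅ u = 0 := by simp [degIn]

open Classical in
theorem degIn_union [DecidableEq V] {Y Z : Finset V} (h : Disjoint Y Z) (u : V) :
    degIn G (Y ∪ Z) u = degIn G Y u + degIn G Z u := by
  rw [degIn, Finset.filter_union,
    Finset.card_union_of_disjoint (Finset.disjoint_filter_filter h)]
  rfl

open Classical in
theorem degIn_insert [DecidableEq V] {Y : Finset V} {v : V} (h : v ∉ Y) (u : V) :
    degIn G (insert v Y) u = indic (G.Adj u v) + degIn G Y u := by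
  rw [Finset.insert_eq, degIn_union G (by simpa using h)]
  congr 1
  rw [degIn, Finset.filter_singleton, indic]
  split_ifs <;> rfl

end degIn

section cuts

variable {n : ℕ} (G : SimpleGraph (Fin n)) (X : Finset (Fin n))

theorem low_union_high (i : ℕ) : low i X ∪ high i X = X := by
  ext w
  simp only [low, high, Finset.mem_union, Finset.mem_filter]
  have := lt_or_ge (w : ℕ) i
  tauto

theorem disjoint_low_high (i : ℕ) : Disjoint (low i X) (high i X) := by
  rw [Finset.disjoint_left]
  simp only [low, high, Finset.mem_filter]
  rintro w ⟨-, h⟩ ⟨-, h'⟩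
  omega

theorem degIn_eq_low_add_high (i : ℕ) (u : Fin n) :
    degIn G X u = degIn G (low i X) u + degIn G (high i X) u := by
  rw [← degIn_union G (disjoint_low_high X i), low_union_high]

theorem low_succ (i : Fin n) :
    low (i + 1) X = if i ∈ X then insert i (low i X) else low i X := by
  split_ifs with h
  all_goals
    ext w
    simp only [low, Finset.mem_insert, Finset.mem_filter, Fin.ext_iff]
    constructor
  · rintro ⟨h₁, h₂⟩
    have := Nat.lt_succ_iff_lt_or_eq.1 h₂
    tauto
  · rintro (h₁ | h₁)
    · have : w = i := Fin.ext h₁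
      exact ⟨this ▸ h, by omega⟩
    · exact ⟨h₁.1, by omega⟩
  · rintro ⟨h₁, h₂⟩
    refine ⟨h₁, lt_of_le_of_ne (by omega) fun h₃ => h ?_⟩
    have : w = i := Fin.ext h₃
    exact this ▸ h₁
  · rintro ⟨h₁, h₂⟩
    exact ⟨h₁, by omega⟩

theorem high_eq (i : Fin n) :
    high i X = if i ∈ X then insert i (high (i + 1) X) else high (i + 1) X := by
  split_ifs with h
  all_goals
    ext w
    simp only [high, Finset.mem_insert, Finset.mem_filter, Fin.ext_iff]
    constructor
  · rintro ⟨h₁, h₂⟩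
    rcases h₂.eq_or_lt with h₂ | h₂
    · exact .inl h₂.symm
    · exact .inr ⟨h₁, h₂⟩
  · rintro (h₁ | h₁)
    · have : w = i := Fin.ext h₁
      exact ⟨this ▸ h, by omega⟩
    · exact ⟨h₁.1, by omega⟩
  · rintro ⟨h₁, h₂⟩
    refine ⟨h₁, lt_of_le_of_ne h₂ fun h₃ => h ?_⟩
    have : w = i := Fin.ext h₃.symm
    exact this ▸ h₁
  · rintro ⟨h₁, h₂⟩
    exact ⟨h₁, by omega⟩

theorem degIn_low_succ {i : Fin n} {p : Prop} (hp : i ∈ X ↔ p) (u : Fin n) :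
    degIn G (low (i + 1) X) u = indic (p ∧ G.Adj u i) + degIn G (low i X) u := by
  rw [low_succ]
  by_cases h : i ∈ X
  · rw [if_pos h, degIn_insert G (by simp [low])]
    simp [hp.1 h]
  · rw [if_neg h, indic_of_not (by simp [mt hp.2 h]), zero_add]

theorem degIn_high {i : Fin n} {p : Prop} (hp : i ∈ X ↔ p) (u : Fin n) :
    degIn G (high i X) u = indic (p ∧ G.Adj u i) + degIn G (high (i + 1) X) u := by
  rw [high_eq]
  by_cases h : i ∈ X
  · rw [if_pos h, degIn_insert G (by simp [high])]
    simp [hp.1 h]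
  · rw [if_neg h, indic_of_not (by simp [mt hp.2 h]), zero_add]

theorem card_low_succ (i : Fin n) :
    (low (i + 1) X).card = (low i X).card + if i ∈ X then 1 else 0 := by
  rw [low_succ]
  split_ifs with h
  · rw [Finset.card_insert_of_notMem (by simp [low])]
  · rfl

theorem high_self : high n X = ∅ := by
  simp only [high, Finset.filter_eq_empty_iff]
  intro w _
  have := w.2
  omega

theorem low_self : low n X = X := by
  simp only [low, Finset.filter_eq_self]
  exact fun w _ => w.2

/-! ### Entries that come from vertex sets. -/

/-- Glue a set before `i`, the vertex `i` if `b`, and a set after `i`. -/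
def glue (i : Fin n) (b : Bool) (X Y : Finset (Fin n)) : Finset (Fin n) :=
  low i X ∪ (if b then {i} else ∅) ∪ high (i + 1) Y

theorem low_glue (i : Fin n) (b : Bool) (Y : Finset (Fin n)) :
    low i (glue i b X Y) = low i X := by
  ext w
  cases b <;>
  · simp only [glue, low, high, Finset.mem_filter, Finset.mem_union]
    simp only [Bool.false_eq_true, if_false, if_true, Finset.notMem_empty, Finset.mem_singleton,
      Fin.ext_iff]
    constructor
    · rintro ⟨(⟨h₁, h₂⟩ | h₁) | h₁, h₃⟩
      · exact ⟨h₁, h₂⟩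
      · first | exact h₁.elim | omega
      · omega
    · tauto

theorem high_glue (i : Fin n) (b : Bool) (Y : Finset (Fin n)) :
    high (i + 1) (glue i b X Y) = high (i + 1) Y := by
  ext w
  cases b <;>
  · simp only [glue, low, high, Finset.mem_filter, Finset.mem_union]
    simp only [Bool.false_eq_true, if_false, if_true, Finset.notMem_empty, Finset.mem_singleton,
      Fin.ext_iff]
    constructor
    · rintro ⟨(h₁ | h₁) | h₁, h₃⟩
      · omega
      · first | exact h₁.elim | omega
      · exact h₁
    · tauto

theorem mem_glue (i : Fin n) (b : Bool) (Y : Finset (Fin n)) :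
    i ∈ glue i b X Y ↔ b = true := by
  cases b <;> simp [glue, low, high]

/-- The entry of kind `0` that describes the vertices of `X` from `j` on. -/
noncomputable def backEntry (d j : ℕ) : Entry n :=
  ⟨0, j, 0, fun u => if (u : ℕ) < j then min d (degIn G (high j X) u) else 0⟩

/-- The entry of kind `1` with the value `s`, for the vertices of `X` before `i` and the vertices
of `Y` from `i` on. -/
noncomputable def cutEntry (d i s : ℕ) (Y : Finset (Fin n)) : Entry n :=
  ⟨1, i, s, fun u => if (u : ℕ) < i then min d (degIn G (high i Y) u)
    else min d (degIn G (low i X) u)⟩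

/-- The entry of kind `1` that describes how `X` is cut at `i`. -/
noncomputable def stateEntry (d i : ℕ) : Entry n := cutEntry G X d i (low i X).card X

theorem inputMem_adj (u v : Fin n) :
    (G.Adj u v → inputMem G 1 (u * n + v) = 1) ∧ (¬ G.Adj u v → inputMem G 1 (u * n + v) = 0) := by
  have hiff : (∃ u' v' : Fin n, G.Adj u' v' ∧ (u : ℕ) * n + v = u' * n + v') ↔ G.Adj u v := by
    constructor
    · rintro ⟨u', v', h, he⟩
      have hn : 0 < n := u.pos
      have h₁ : (u : ℕ) = u' := by
        have := congrArg (· / n) he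
        simpa [Nat.add_comm _ (v : ℕ), Nat.add_comm _ (v' : ℕ), Nat.add_mul_div_right _ _ hn,
          Nat.div_eq_of_lt] using this
      have h₂ : (v : ℕ) = v' := by
        rw [h₁] at he
        omega
      rwa [Fin.ext h₁, Fin.ext h₂]
    · exact fun h => ⟨u, v, h, rfl⟩
  constructor <;> intro h
  · rw [inputMem, if_neg (by simp), if_pos ⟨rfl, hiff.2 h⟩]
  · rw [inputMem, if_neg (by simp), if_neg fun h' => h (hiff.1 h'.2)]

/-- For two bits, the truncated difference `x + a - 1` is their product; the machine cannot
multiply. -/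
theorem gain_eq (x : ℕ) (hx : x < 2) (u v : Fin n) :
    gain n (inputMem G 1) x u v = indic (x = 1 ∧ G.Adj u v) := by
  obtain ⟨h₁, h₂⟩ := inputMem_adj G u v
  rw [gain]
  by_cases h : G.Adj u v
  · rw [h₁ h]
    interval_cases x <;> simp [h, indic]
  · rw [h₂ h]
    interval_cases x <;> simp [h, indic]

theorem combine_backEntry (d : ℕ) (j : Fin n) {x : ℕ} (hx : x < 2) (hxX : j ∈ X ↔ x = 1)
    (Q : Entry n) :
    (backEntry G X d (j + 1)).combine d (inputMem G 1) x Q = backEntry G X d j := by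
  refine Entry.ext rfl ?_ rfl (funext fun u => ?_)
  · simp [Entry.combine, backEntry]
  · simp only [Entry.combine, backEntry, if_true, Nat.add_sub_cancel]
    split_ifs with h h'
    · rw [gain_eq G x hx, degIn_high G X hxX]
      omega
    · omega
    · rfl

/-- After the move, vertex `i` lies before the cut. The vertices up to `i` now need their counts
towards the suffix from `i + 1` on, which the back entry supplies. -/
theorem combine_stateEntry (d : ℕ) (i : Fin n) {x : ℕ} (hx : x < 2) (hxX : i ∈ X ↔ x = 1) :
    (stateEntry G X d i).combine d (inputMem G 1) x (backEntry G X d (i + 1)) =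
      stateEntry G X d (i + 1) := by
  refine Entry.ext rfl rfl ?_ (funext fun u => ?_)
  · simp only [Entry.combine, stateEntry, cutEntry, card_low_succ, hxX, one_ne_zero, if_false]
    congr 1
    split_ifs <;> omega
  · simp only [Entry.combine, stateEntry, cutEntry, backEntry, one_ne_zero, if_false]
    by_cases h : (i : ℕ) < u
    · have h₁ : ¬ (u : ℕ) < i := by omega
      have h₂ : ¬ (u : ℕ) < i + 1 := by omega
      simp only [h, h₁, h₂, if_true, if_false, gain_eq G x hx, degIn_low_succ G X hxX]
      omega
    · have h₂ : (u : ℕ) < i + 1 := by omega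
      simp only [h, h₂, if_true, if_false]

/-- The condition on a `(σ, ρ)`-set, at the vertex `v`. -/
def VertexOk (d : ℕ) (σ ρ : Set ℕ) (v : Fin n) : Prop :=
  min d (degIn G X v) ∈ if v ∈ X then σ else ρ

/-- If both entries come from the same `X`, all predictions are confirmed and only the constraint at
`i` remains. It can be read off truncated counts because `min d (a + b) = min d (min d a + min d
b)`, and `i` itself adds nothing to its own count. -/
theorem fits_stateEntry {d : ℕ} {σ ρ : Set ℕ} {τ : ℕ → List ℕ}
    (hσ : ∀ t ≤ d, t ∈ τ 1 ↔ t ∈ σ) (hρ : ∀ t ≤ d, t ∈ τ 0 ↔ t ∈ ρ) (i : Fin n) {x : ℕ}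
    (hx : x < 2) (hxX : i ∈ X ↔ x = 1) :
    (stateEntry G X d i).Fits d (inputMem G 1) (τ x) x (backEntry G X d (i + 1)) ↔
      VertexOk G X d σ ρ i := by
  have hdeg : degIn G X i = degIn G (low i X) i + degIn G (high (i + 1) X) i := by
    rw [degIn_eq_low_add_high G X i, degIn_high G X hxX,
      indic_of_not (by simp), zero_add]
  have hmin : min d (degIn G X i) =
      min d (min d (degIn G (low i X) i) + min d (degIn G (high (i + 1) X) i)) := by
    rw [hdeg]
    omega
  have hτ : min d (degIn G X i) ∈ τ x ↔ VertexOk G X d σ ρ i := by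
    rw [VertexOk]
    by_cases h : i ∈ X
    · rw [if_pos h, hxX.1 h]
      exact hσ _ (min_le_left _ _)
    · have : x = 0 := by
        rw [hxX] at h
        omega
      rw [if_neg h, this]
      exact hρ _ (min_le_left _ _)
  rw [← hτ, hmin]
  simp only [Entry.Fits, stateEntry, cutEntry, backEntry, one_ne_zero, if_false, true_and]
  constructor
  · intro h
    have := (h i).2 rfl
    rwa [if_neg (by omega), if_pos (by omega)] at this
  · intro h u
    refine ⟨fun hu => ?_, fun hu => ?_⟩
    · rw [if_pos (by omega), if_pos hu, gain_eq G x hx, degIn_high G X hxX]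
      omega
    · obtain rfl : u = i := Fin.ext hu
      rwa [if_neg (by omega), if_pos (by omega)]

open Classical in
/-- The entries that describe partial solutions. -/
noncomputable def entries (d : ℕ) (σ ρ : Set ℕ) : Finset (Entry n) :=
  (Finset.range (n + 1) ×ˢ Finset.univ).image (fun q => backEntry G q.2 d q.1) ∪
    ((Finset.range (n + 1) ×ˢ Finset.univ).filter fun q : ℕ × Finset (Fin n) =>
      ∀ v : Fin n, (v : ℕ) < q.1 → VertexOk G q.2 d σ ρ v).image (fun q => stateEntry G q.2 d q.1)

theorem mem_entries {d : ℕ} {σ ρ : Set ℕ} {P : Entry n} : P ∈ entries G d σ ρ ↔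
    (∃ j ≤ n, ∃ X, P = backEntry G X d j) ∨
      ∃ i ≤ n, ∃ X, (∀ v : Fin n, (v : ℕ) < i → VertexOk G X d σ ρ v) ∧ P = stateEntry G X d i := by
  classical
  simp only [entries, Finset.mem_union, Finset.mem_image, Finset.mem_filter, Finset.mem_product,
    Finset.mem_range, Finset.mem_univ, and_true, Prod.exists, Nat.lt_succ_iff]
  refine or_congr ⟨?_, ?_⟩ ⟨?_, ?_⟩
  · rintro ⟨j, X, h, rfl⟩
    exact ⟨j, h, X, rfl⟩
  · rintro ⟨j, h, X, rfl⟩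
    exact ⟨j, X, h, rfl⟩
  · rintro ⟨j, X, ⟨h, h'⟩, rfl⟩
    exact ⟨j, h, X, h', rfl⟩
  · rintro ⟨j, h, X, h', rfl⟩
    exact ⟨j, X, ⟨h, h'⟩, rfl⟩

theorem backEntry_congr {X Y : Finset (Fin n)} {d j : ℕ} (h : high j X = high j Y) :
    backEntry G X d j = backEntry G Y d j := by
  rw [backEntry, backEntry, h]

/-- An exchange argument: if a state of `X` fits a back entry of `Y`, the prefix of `X`, the choice
at `i` and the suffix of `Y` are glued to a set `Z` with the same two entries. The combination is
then an honest state of `Z`. -/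
theorem closed_entries {d : ℕ} {σ ρ : Set ℕ} {τ : ℕ → List ℕ}
    (hσ : ∀ t ≤ d, t ∈ τ 1 ↔ t ∈ σ) (hρ : ∀ t ≤ d, t ∈ τ 0 ↔ t ∈ ρ) :
    Closed d (inputMem G 1) τ (entries G d σ ρ) := by
  intro x hx P hP Q hQ hf
  rw [mem_entries] at hP hQ ⊢
  rcases hP with ⟨j, hj, X, rfl⟩ | ⟨i, hi, X, hX, rfl⟩
  · obtain ⟨j, rfl⟩ : ∃ k, j = k + 1 :=
      Nat.exists_eq_succ_of_ne_zero (by simpa [Entry.Fits, backEntry] using hf)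
    let j' : Fin n := ⟨j, hj⟩
    -- A back entry does not depend on the prefix, so the empty one is taken.
    refine .inl ⟨j, by omega, glue j' (decide (x = 1)) ∅ X, ?_⟩
    rw [backEntry_congr G (high_glue ∅ j' (decide (x = 1)) X).symm]
    exact combine_backEntry G _ d j' hx (by simp [mem_glue]) Q
  · obtain ⟨hk, hl⟩ : Q.kind = 0 ∧ Q.level = i + 1 := by
      simp only [Entry.Fits, stateEntry, cutEntry, one_ne_zero, if_false] at hf
      exact hf.1
    rcases hQ with ⟨j, hj, Y, rfl⟩ | ⟨j, hj, Y, hY, rfl⟩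
    · obtain rfl : j = i + 1 := hl
      let i' : Fin n := ⟨i, hj⟩
      set Z := glue i' (decide (x = 1)) X Y with hZ
      have hlow : low i Z = low i X := low_glue X i' _ Y
      have hmem : i' ∈ Z ↔ x = 1 := by simp [hZ, mem_glue]
      have hQ : backEntry G Y d (i + 1) = backEntry G Z d (i + 1) :=
        backEntry_congr G (high_glue X i' _ Y).symm
      rw [hQ] at hf ⊢
      -- The confirmed predictions say that `X` and `Z` have the same truncated counts beyond the
      -- cut. This preserves both the state at `i` and the constraints already checked.
      have hdeg : ∀ u : Fin n, (u : ℕ) < i →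
          min d (degIn G (high i X) u) = min d (degIn G (high i Z) u) := by
        intro u hu
        have h := hf
        simp only [Entry.Fits, stateEntry, cutEntry, backEntry, one_ne_zero, if_false] at h
        have := (h.2 u).1 hu
        rw [if_pos hu, if_pos (by omega), show i = ((i' : Fin n) : ℕ) from rfl,
          gain_eq G x hx] at this
        rw [← this, show i = ((i' : Fin n) : ℕ) from rfl, degIn_high G Z hmem]
        omega
      have hP : stateEntry G X d i = stateEntry G Z d i := by
        refine Entry.ext rfl rfl ?_ (funext fun u => ?_)
        · simp [stateEntry, cutEntry, hlow]
        · simp only [stateEntry, cutEntry, hlow]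
          split_ifs with hu
          · exact hdeg u hu
          · rfl
      rw [hP] at hf ⊢
      refine .inr ⟨i + 1, hj, Z, fun v hv => ?_, combine_stateEntry G Z d i' hx hmem⟩
      rcases Nat.lt_succ_iff_lt_or_eq.1 hv with hv | hv
      · have h := hX v hv
        rw [VertexOk] at h ⊢
        have hmem' : v ∈ Z ↔ v ∈ X := by
          have := congrArg (v ∈ ·) hlow
          simpa [low, hv] using this
        have hmin : min d (degIn G Z v) = min d (degIn G X v) := by
          rw [degIn_eq_low_add_high G Z i, degIn_eq_low_add_high G X i, hlow]
          have := hdeg v hv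
          omega
        simp only [hmem', hmin]
        exact h
      · rw [show v = i' from Fin.ext hv]
        exact (fits_stateEntry G Z hσ hρ i' hx hmem).1 hf
    · simp [stateEntry, cutEntry] at hk

theorem initialEntries_subset {d : ℕ} {σ ρ : Set ℕ} :
    backEntry G ∅ d n = ⟨0, n, 0, 0⟩ ∧ stateEntry G ∅ d 0 = ⟨1, 0, 0, 0⟩ ∧
      ∀ P ∈ initialEntries n, P ∈ entries G d σ ρ := by
  have h₁ : backEntry G ∅ d n = ⟨0, n, 0, 0⟩ := by
    simp [backEntry, high, Pi.zero_def]
  have h₂ : stateEntry G ∅ d 0 = ⟨1, 0, 0, 0⟩ := by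
    simp [stateEntry, cutEntry, low, Pi.zero_def]
  refine ⟨h₁, h₂, fun P hP => ?_⟩
  rw [mem_entries]
  simp only [initialEntries, List.mem_cons, List.not_mem_nil, or_false] at hP
  rcases hP with rfl | rfl
  · exact .inl ⟨n, le_rfl, ∅, h₁.symm⟩
  · exact .inr ⟨0, n.zero_le, ∅, fun v hv => absurd hv (by omega), h₂.symm⟩

theorem isSigmaRhoSet_iff {d : ℕ} {σ ρ : Set ℕ} (hσ : FinOrCofin σ) (hρ : FinOrCofin ρ)
    (hdσ : dSet σ ≤ d) (hdρ : dSet ρ ≤ d) :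
    IsSigmaRhoSet G σ ρ (X : Set (Fin n)) ↔ ∀ v, VertexOk G X d σ ρ v := by
  refine forall_congr' fun v => ?_
  have : (G.neighborSet v ∩ (X : Set (Fin n))).ncard = degIn G X v := by
    classical
    rw [degIn, ← Set.ncard_coe_finset]
    congr 1
    ext w
    simp [and_comm]
  rw [this, VertexOk]
  by_cases h : v ∈ X
  · simp [h, min_mem_iff hσ hdσ]
  · simp [h, min_mem_iff hρ hdρ]

/-- A state at level `n` has passed the constraints of all vertices, so its value is the size of a
solution. Conversely, all back entries and then all states of a given solution are generated. -/
theorem values_eq_sigmaRhoSizes {d : ℕ} {σ ρ : Set ℕ} {τ : ℕ → List ℕ}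
    (hσ : ∀ t ≤ d, t ∈ τ 1 ↔ t ∈ σ) (hρ : ∀ t ≤ d, t ∈ τ 0 ↔ t ∈ ρ)
    (hσ' : FinOrCofin σ) (hρ' : FinOrCofin ρ) (hdσ : dSet σ ≤ d) (hdρ : dSet ρ ≤ d)
    {L : List (Entry n)} (hL : ∀ P ∈ L, P ∈ entries G d σ ρ) (hL' : ∀ P ∈ initialEntries n, P ∈ L)
    (hd : ∀ P ∈ L, ∀ Q ∈ L, Done d (inputMem G 1) τ L P Q) :
    {s | ∃ P ∈ L, P.kind ≠ 0 ∧ P.level = n ∧ P.val = s} = sigmaRhoSizes G σ ρ := by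
  classical
  obtain ⟨h₁, h₂, -⟩ := initialEntries_subset G (d := d) (σ := σ) (ρ := ρ)
  -- Back entries are built from the end of the order, hence the induction on the length `k` of the
  -- suffix.
  have hback : ∀ X : Finset (Fin n), ∀ k ≤ n, backEntry G X d (n - k) ∈ L := by
    intro X k
    induction k with
    | zero =>
      intro _
      rw [Nat.sub_zero, backEntry_congr G (Y := ∅) (by rw [high_self, high_self]), h₁]
      exact hL' _ (by simp [initialEntries])
    | succ k ih =>
      intro hk
      have hP := ih (by omega)
      let j : Fin n := ⟨n - (k + 1), by omega⟩
      have hj : n - k = (j : ℕ) + 1 := by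
        simp only [j]
        omega
      rw [hj] at hP
      have := hd _ hP _ hP (if j ∈ X then 1 else 0) (by split_ifs <;> omega)
        (by simp [Entry.Fits, backEntry])
      rwa [combine_backEntry G X d j (by split_ifs <;> omega) (by simp)] at this
  ext s
  constructor
  · rintro ⟨P, hP, hk, hl, rfl⟩
    rcases (mem_entries G).1 (hL P hP) with ⟨j, hj, X, rfl⟩ | ⟨i, hi, X, hX, rfl⟩
    · exact absurd rfl hk
    · obtain rfl : i = n := hl
      refine ⟨X, (isSigmaRhoSet_iff G X hσ' hρ' hdσ hdρ).2 fun v => hX v v.2, ?_⟩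
      simp [stateEntry, cutEntry, low_self]
  · rintro ⟨X, hX, rfl⟩
    obtain ⟨X, rfl⟩ : ∃ Y : Finset (Fin n), (Y : Set (Fin n)) = X := ⟨X.toFinset, by simp⟩
    rw [isSigmaRhoSet_iff G X hσ' hρ' hdσ hdρ] at hX
    have hstate : ∀ i ≤ n, stateEntry G X d i ∈ L := by
      intro i
      induction i with
      | zero =>
        intro _
        have : stateEntry G X d 0 = stateEntry G ∅ d 0 := by
          simp [stateEntry, cutEntry, low]
        rw [this, h₂]
        exact hL' _ (by simp [initialEntries])
      | succ i ih =>
        intro hi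
        let i' : Fin n := ⟨i, hi⟩
        have hx : (if i' ∈ X then 1 else 0) < 2 := by split_ifs <;> omega
        have hQ := hback X (n - (i + 1)) (by omega)
        rw [show n - (n - (i + 1)) = i + 1 by omega] at hQ
        have := hd _ (ih (by omega)) _ hQ _ hx
          ((fits_stateEntry G X hσ hρ i' hx (by simp)).2 (hX i'))
        rwa [combine_stateEntry G X d i' hx (by simp)] at this
    refine ⟨_, hstate n le_rfl, by simp [stateEntry, cutEntry], rfl, ?_⟩
    simp [stateEntry, cutEntry, low_self, Set.ncard_coe_finset]

end cuts

end RAM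

/-! ## The number of entries -/

/-- There are vertices `y 0, …, y (r - 1)` and different ones `b 0, …, b (r - 1)` such that `b j` is
adjacent to `y i` exactly if `i = j`. -/
def SimpleGraph.HasCrossMatching {V : Type*} (G : SimpleGraph V) (r : ℕ) : Prop :=
  ∃ y b : Fin r → V, (∀ i j, y i ≠ b j) ∧ ∀ i j, G.Adj (b j) (y i) ↔ i = j

namespace RAM

section representatives

variable {V : Type*} {G : SimpleGraph V} {r : ℕ}

/-- Every set on one side of a cut has a small subset that dominates the same vertices on the other
side, unless there is a large induced matching across the cut. -/
theorem exists_small_dominating (hG : ¬ G.HasCrossMatching (r + 1)) (p : V → Prop) (Z : Finset V)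
    (hZ : ∀ w ∈ Z, p w) :
    ∃ Y ⊆ Z, Y.card ≤ r ∧ ∀ u, ¬ p u → ∀ w ∈ Z, G.Adj u w → ∃ w' ∈ Y, G.Adj u w' := by
  classical
  induction Z using Finset.strongInduction with
  | H Z ih =>
    -- Either every `w ∈ Z` has a private neighbour across the cut, or some `w` is redundant and can
    -- be deleted.
    by_cases hpriv : ∀ w ∈ Z, ∃ u, ¬ p u ∧ G.Adj u w ∧ ∀ w' ∈ Z, G.Adj u w' → w' = w
    · refine ⟨Z, subset_rfl, ?_, fun u _ w hw h => ⟨w, hw, h⟩⟩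
      by_contra hc
      obtain ⟨Z', hZ', hcard⟩ := Finset.exists_subset_card_eq (not_le.1 hc)
      choose f hf hf' hf'' using hpriv
      let e := (Finset.equivFinOfCardEq hcard).symm
      have hmem : ∀ i, (e i : V) ∈ Z := fun i => hZ' (e i).2
      -- Vertices of `Z` together with their private neighbours form an induced matching across the
      -- cut.
      refine hG ⟨fun i => e i, fun i => f (e i) (hmem i), fun i j h => ?_, fun i j => ⟨fun h => ?_, ?_⟩⟩
      · have h' := hZ _ (hmem i)
        rw [show (e i : V) = f (e j) (hmem j) from h] at h'
        exact hf _ (hmem j) h'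
      · exact e.injective (Subtype.ext (hf'' _ (hmem j) _ (hmem i) h))
      · rintro rfl
        exact hf' _ (hmem i)
    · push Not at hpriv
      obtain ⟨w, hw, hpriv⟩ := hpriv
      obtain ⟨Y, hY, hY', hY''⟩ := ih (Z.erase w) (Finset.erase_ssubset hw)
        fun w' hw' => hZ w' (Finset.mem_of_mem_erase hw')
      refine ⟨Y, hY.trans (Finset.erase_subset _ _), hY', fun u hu w' hw' h => ?_⟩
      by_cases hww : w' = w
      · rw [hww] at h
        obtain ⟨w'', h₁, h₂, h₃⟩ := hpriv u hu h
        exact hY'' u hu w'' (Finset.mem_erase.2 ⟨h₃, h₁⟩) h₂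
      · exact hY'' u hu w' (Finset.mem_erase.2 ⟨hww, hw'⟩) h

/-- Peel off `d` dominating sets, one after the other. A vertex `u` without neighbours in the first
one has none in `Z`. Otherwise the first set contributes at least `1` to both counts, and the
induction hypothesis for the remainder, truncated at one less, gives equality. -/
theorem exists_small_representative (hG : ¬ G.HasCrossMatching (r + 1)) (p : V → Prop) (d : ℕ)
    (Z : Finset V) (hZ : ∀ w ∈ Z, p w) :
    ∃ Y ⊆ Z, Y.card ≤ d * r ∧ ∀ u, ¬ p u → min d (degIn G Y u) = min d (degIn G Z u) := by
  classical
  induction d generalizing Z with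
  | zero => exact ⟨∅, by simp, by simp, by simp⟩
  | succ d ih =>
    obtain ⟨Y, hY, hYr, hYd⟩ := exists_small_dominating hG p Z hZ
    obtain ⟨Y', hY', hYr', hYd'⟩ := ih (Z \ Y) fun w hw => hZ w (Finset.mem_sdiff.1 hw).1
    have hdisj : Disjoint Y Y' :=
      Finset.disjoint_of_subset_right hY' Finset.disjoint_sdiff
    refine ⟨Y ∪ Y', Finset.union_subset hY (hY'.trans Finset.sdiff_subset), ?_, fun u hu => ?_⟩
    · refine (Finset.card_union_le _ _).trans ?_
      rw [add_mul]
      omega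
    · have hZe : degIn G Z u = degIn G Y u + degIn G (Z \ Y) u := by
        rw [← degIn_union G Finset.disjoint_sdiff, Finset.union_sdiff_of_subset hY]
      rw [degIn_union G hdisj]
      by_cases h0 : degIn G Y u = 0
      · rw [degIn, Finset.card_eq_zero, Finset.filter_eq_empty_iff] at h0
        have hz : ∀ W ⊆ Z, degIn G W u = 0 := by
          intro W hW
          rw [degIn, Finset.card_eq_zero, Finset.filter_eq_empty_iff]
          intro w hw h
          obtain ⟨w', hw', h'⟩ := hYd u hu w (hW hw) h
          exact h0 hw' h'
        rw [hz Z subset_rfl, hz Y hY, hz Y' (hY'.trans Finset.sdiff_subset)]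
      · have := hYd' u hu
        omega

end representatives

/-- A set of at most `k` elements is listed as a `k`-tuple padded with `none`. -/
theorem card_filter_card_le (n k : ℕ) :
    ((Finset.univ : Finset (Finset (Fin n))).filter fun Y => Y.card ≤ k).card ≤ (n + 1) ^ k := by
  classical
  calc _ ≤ ((Finset.univ : Finset (Fin k → Option (Fin n))).image
        fun f => Finset.univ.filter fun v => ∃ i, f i = some v).card := by
        refine Finset.card_le_card fun Y hY => ?_
        rw [Finset.mem_image]
        refine ⟨fun i => Y.toList[(i : ℕ)]?, Finset.mem_univ _, ?_⟩
        ext v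
        simp only [Finset.mem_filter, Finset.mem_univ, true_and] at hY ⊢
        rw [← Finset.mem_toList, List.mem_iff_getElem?]
        constructor
        · rintro ⟨i, hi⟩
          exact ⟨i, hi⟩
        · rintro ⟨i, hi⟩
          have : i < Y.toList.length := (List.getElem?_eq_some_iff.1 hi).1
          rw [Finset.length_toList] at this
          exact ⟨⟨i, by omega⟩, hi⟩
    _ ≤ _ := Finset.card_image_le
    _ = _ := by simp

variable {n : ℕ} {G : SimpleGraph (Fin n)} {r : ℕ}

theorem low_eq_self {i : ℕ} {Y : Finset (Fin n)} (h : ∀ w ∈ Y, (w : ℕ) < i) : low i Y = Y :=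
  Finset.filter_true_of_mem h

theorem high_eq_self {i : ℕ} {Y : Finset (Fin n)} (h : ∀ w ∈ Y, i ≤ (w : ℕ)) : high i Y = Y :=
  Finset.filter_true_of_mem h

theorem exists_small_low (hG : ¬ G.HasCrossMatching (r + 1)) (d i : ℕ) (X : Finset (Fin n)) :
    ∃ Y : Finset (Fin n), Y.card ≤ d * r ∧
      ∀ u : Fin n, ¬ (u : ℕ) < i → min d (degIn G (low i Y) u) = min d (degIn G (low i X) u) := by
  obtain ⟨Y, hY, hY', h⟩ := exists_small_representative hG (fun w : Fin n => (w : ℕ) < i) d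
    (low i X) fun w hw => (Finset.mem_filter.1 hw).2
  refine ⟨Y, hY', ?_⟩
  rwa [low_eq_self fun w hw => (Finset.mem_filter.1 (hY hw)).2]

theorem exists_small_high (hG : ¬ G.HasCrossMatching (r + 1)) (d i : ℕ) (X : Finset (Fin n)) :
    ∃ Y : Finset (Fin n), Y.card ≤ d * r ∧
      ∀ u : Fin n, (u : ℕ) < i → min d (degIn G (high i Y) u) = min d (degIn G (high i X) u) := by
  obtain ⟨Y, hY, hY', h⟩ := exists_small_representative hG (fun w : Fin n => i ≤ (w : ℕ)) d
    (high i X) fun w hw => (Finset.mem_filter.1 hw).2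
  refine ⟨Y, hY', ?_⟩
  rw [high_eq_self fun w hw => (Finset.mem_filter.1 (hY hw)).2]
  exact fun u hu => h u (by omega)

/-- A back entry is determined by its level and one representative; a state by its level, its value
and one representative for each side. The value is recorded separately since representatives do not
preserve sizes. This gives `2 * (d * r)` in the exponent; the cube absorbs levels, values and the
summand `1`. -/
theorem card_entries_le (hG : ¬ G.HasCrossMatching (r + 1)) (d : ℕ) (σ ρ : Set ℕ) :
    (entries G d σ ρ).card + 1 ≤ (n + 4) ^ (2 * (d * r) + 3) := by
  classical
  set F := (Finset.univ : Finset (Finset (Fin n))).filter fun Y => Y.card ≤ d * r with hF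
  have hFc : F.card ≤ (n + 1) ^ (d * r) := card_filter_card_le n (d * r)
  have hsub : entries G d σ ρ ⊆
      (Finset.range (n + 1) ×ˢ F).image (fun q => backEntry G q.2 d q.1) ∪
        ((Finset.range (n + 1) ×ˢ Finset.range (n + 1)) ×ˢ (F ×ˢ F)).image
          (fun q => cutEntry G q.2.1 d q.1.1 q.1.2 q.2.2) := by
    intro P hP
    rw [Finset.mem_union, Finset.mem_image, Finset.mem_image]
    rcases (mem_entries G).1 hP with ⟨j, hj, X, rfl⟩ | ⟨i, hi, X, -, rfl⟩
    · left
      obtain ⟨Y, hY, h⟩ := exists_small_high hG d j X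
      refine ⟨(j, Y), by simp [hF, hY]; omega, ?_⟩
      refine Entry.ext rfl rfl rfl (funext fun u => ?_)
      simp only [backEntry]
      split_ifs with hu
      · exact h u hu
      · rfl
    · right
      obtain ⟨Y, hY, h⟩ := exists_small_low hG d i X
      obtain ⟨Z, hZ, h'⟩ := exists_small_high hG d i X
      have hc : (low i X).card ≤ n := (Finset.card_le_univ _).trans (by simp)
      refine ⟨((i, (low i X).card), (Y, Z)), ?_, ?_⟩
      · simp only [hF, Finset.mem_product, Finset.mem_range, Finset.mem_filter, Finset.mem_univ,
          true_and]
        omega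
      · refine Entry.ext rfl rfl rfl (funext fun u => ?_)
        simp only [cutEntry, stateEntry]
        split_ifs with hu
        · exact h' u hu
        · exact h u hu
  have h₁ := Finset.card_le_card hsub
  have h₂ := h₁.trans ((Finset.card_union_le _ _).trans
    (Nat.add_le_add Finset.card_image_le Finset.card_image_le))
  simp only [Finset.card_product, Finset.card_range] at h₂
  set N := (n + 4) ^ (d * r) with hN
  have hFN : F.card ≤ N := hFc.trans (Nat.pow_le_pow_left (by omega) _)
  have hN1 : 1 ≤ N := Nat.one_le_pow _ _ (by omega)
  have hpow : (n + 4) ^ (2 * (d * r) + 3) = (n + 4) ^ 3 * (N * N) := by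
    rw [hN]
    ring
  rw [hpow]
  have hNN : N ≤ N * N := Nat.le_mul_of_pos_left _ hN1
  calc _ ≤ (n + 1) * F.card + (n + 1) * (n + 1) * (F.card * F.card) + 1 := by omega
    _ ≤ (n + 1) * (N * N) + (n + 1) * (n + 1) * (N * N) + 1 * (N * N) := by
      gcongr
      · exact hFN.trans hNN
      · omega
    _ = ((n + 1) + (n + 1) * (n + 1) + 1) * (N * N) := by ring
    _ ≤ _ := by
      gcongr
      nlinarith [Nat.zero_le (n ^ 3), Nat.zero_le (n ^ 2)]

end RAM

/-! ## Random graphs -/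

namespace SimpleGraph

open MeasureTheory ProbabilityTheory unitInterval

variable {V : Type*}

/-- The probability that the random graph has none of the edges in `E`. -/
theorem binomialRandom_forall_notMem_edgeSet_le [Countable V] (p : unitInterval)
    (E : Finset (Sym2 V)) (hE : ∀ e ∈ E, ¬ e.IsDiag) :
    binomialRandom V p {G | ∀ e ∈ E, e ∉ G.edgeSet} ≤ (toNNReal (σ p) : ENNReal) ^ E.card := by
  rw [binomialRandom_apply]
  -- The edges are independent coordinates of a product measure, so the box has the product of the
  -- probabilities.
  refine (measure_mono (t := Set.pi (E : Set (Sym2 V)) fun _ => {False}) ?_).trans ?_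
  · rintro _ ⟨G, hG, rfl⟩ e he
    simpa using hG e he
  · rw [Measure.infinitePi_pi _ (fun _ _ => MeasurableSet.of_discrete)]
    refine (Finset.prod_congr rfl fun e he => ?_).trans_le (Finset.prod_const _).le
    rw [Measure.add_apply, Measure.smul_apply, Measure.smul_apply]
    simp [hE e he]

/-- The pairs `b j`, `y i` with `i ≠ j` must be non-edges. They are `r * (r - 1)` different pairs
because the `y i` are distinct, the `b j` are distinct and the two families are disjoint; otherwise
the event is empty. -/
theorem binomialRandom_crossMatching_le [Countable V] (p : unitInterval) {r : ℕ} (y b : Fin r → V) :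
    binomialRandom V p {G | (∀ i j, y i ≠ b j) ∧ ∀ i j, G.Adj (b j) (y i) ↔ i = j} ≤
      (toNNReal (σ p) : ENNReal) ^ (r * (r - 1)) := by
  classical
  by_cases h : (∀ i j, y i ≠ b j) ∧ Function.Injective y ∧ Function.Injective b
  · obtain ⟨h₁, h₂, h₃⟩ := h
    set E := (Finset.univ : Finset (Fin r)).offDiag.image fun q => s(b q.2, y q.1) with hE
    have hcard : E.card = r * (r - 1) := by
      rw [hE, Finset.card_image_of_injective, Finset.offDiag_card, Finset.card_univ,
        Fintype.card_fin, Nat.mul_sub_one]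
      rintro ⟨i, j⟩ ⟨i', j'⟩ hq
      rcases Sym2.eq_iff.1 hq with ⟨hb, hy⟩ | ⟨hb, -⟩
      · exact Prod.ext (h₂ hy) (h₃ hb)
      · exact absurd hb.symm (h₁ _ _)
    rw [← hcard]
    refine (measure_mono ?_).trans (binomialRandom_forall_notMem_edgeSet_le p E ?_)
    · rintro G ⟨-, hG⟩ e he
      obtain ⟨⟨i, j⟩, hij, rfl⟩ := Finset.mem_image.1 he
      rw [mem_edgeSet, hG]
      simpa using hij
    · intro e he
      obtain ⟨⟨i, j⟩, -, rfl⟩ := Finset.mem_image.1 he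
      exact fun hd => h₁ i j hd.symm
  · convert zero_le (a := (toNNReal (σ p) : ENNReal) ^ (r * (r - 1)))
    convert measure_empty (μ := binomialRandom V p)
    rw [Set.eq_empty_iff_forall_notMem]
    rintro G ⟨h₁, h₂⟩
    refine h ⟨h₁, fun i j hij => ?_, fun i j hij => ?_⟩
    · have := (h₂ j j).2 rfl
      rw [← hij] at this
      exact (h₂ i j).1 this
    · have := (h₂ i i).2 rfl
      rw [hij] at this
      exact (h₂ i j).1 this

/-- Union bound over the `n ^ (2 * (r + 1))` choices of `y` and `b`. -/
theorem binomialRandom_hasCrossMatching_le (n : ℕ) (p : unitInterval) (r : ℕ) :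
    binomialRandom (Fin n) p {G | G.HasCrossMatching (r + 1)} ≤
      ((n : ENNReal) ^ 2 * (toNNReal (σ p) : ENNReal) ^ r) ^ (r + 1) := by
  have h : {G : SimpleGraph (Fin n) | G.HasCrossMatching (r + 1)} ⊆
      ⋃ q : (Fin (r + 1) → Fin n) × (Fin (r + 1) → Fin n),
        {G | (∀ i j, q.1 i ≠ q.2 j) ∧ ∀ i j, G.Adj (q.2 j) (q.1 i) ↔ i = j} := by
    rintro G ⟨y, b, h⟩
    exact Set.mem_iUnion.2 ⟨(y, b), h⟩
  refine (measure_mono h).trans ((measure_iUnion_fintype_le _ _).trans ?_)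
  refine (Finset.sum_le_sum fun q _ => binomialRandom_crossMatching_le p q.1 q.2).trans ?_
  rw [Finset.sum_const, Finset.card_univ, nsmul_eq_mul]
  simp only [Fintype.card_prod, Fintype.card_fun, Fintype.card_fin, Nat.add_sub_cancel]
  refine le_of_eq ?_
  push_cast
  ring

/-- Sufficiently large cross matchings almost surely do not exist. -/
theorem tendsto_binomialRandom_hasCrossMatching (p : unitInterval) {L : ℕ}
    (hL : toNNReal (σ p) ^ L ≤ 2⁻¹) :
    Filter.Tendsto (fun n : ℕ => binomialRandom (Fin n) p
      {G | G.HasCrossMatching (3 * L * (Nat.log 2 n + 1) + 1)}) Filter.atTop (nhds 0) := by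
  refine tendsto_of_tendsto_of_tendsto_of_le_of_le' tendsto_const_nhds
    ENNReal.tendsto_inv_nat_nhds_zero (.of_forall fun _ => zero_le) ?_
  filter_upwards [Filter.eventually_ge_atTop 1] with n hn
  refine (binomialRandom_hasCrossMatching_le n p _).trans ?_
  set q := toNNReal (σ p)
  have hn0 : (n : NNReal) ≠ 0 := by exact_mod_cast (by omega : n ≠ 0)
  have h₁ : (2⁻¹ : NNReal) ^ (Nat.log 2 n + 1) ≤ (n : NNReal)⁻¹ := by
    rw [inv_pow]
    refine inv_anti₀ (by positivity) ?_
    exact_mod_cast (Nat.lt_pow_succ_log_self (by omega) n).le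
  -- The factor `3` is chosen so that `q ^ r ≤ n⁻¹ ^ 3` still beats `n ^ 2` and leaves `n⁻¹`; the
  -- outer exponent only helps.
  have h₂ : q ^ (3 * L * (Nat.log 2 n + 1)) ≤ (n : NNReal)⁻¹ ^ 3 := by
    calc q ^ (3 * L * (Nat.log 2 n + 1)) = ((q ^ L) ^ (Nat.log 2 n + 1)) ^ 3 := by ring
      _ ≤ _ := by
        gcongr
        exact (pow_le_pow_left₀ zero_le hL _).trans h₁
  have h₃ : (n : NNReal) ^ 2 * q ^ (3 * L * (Nat.log 2 n + 1)) ≤ (n : NNReal)⁻¹ := by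
    calc _ ≤ (n : NNReal) ^ 2 * (n : NNReal)⁻¹ ^ 3 := by gcongr
      _ = _ := by field_simp
  have h₄ : (n : NNReal)⁻¹ ≤ 1 := inv_le_one_of_one_le₀ (by exact_mod_cast hn)
  have h₅ : ((n : NNReal) ^ 2 * q ^ (3 * L * (Nat.log 2 n + 1))) ^
      (3 * L * (Nat.log 2 n + 1) + 1) ≤ (n : NNReal)⁻¹ :=
    (pow_le_of_le_one zero_le (h₃.trans h₄) (by omega)).trans h₃
  have h₆ := ENNReal.coe_le_coe.2 h₅
  rwa [ENNReal.coe_inv hn0, ENNReal.coe_pow, ENNReal.coe_mul, ENNReal.coe_pow, ENNReal.coe_pow,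
    ENNReal.coe_natCast] at h₆

end SimpleGraph

/-! ## The running time -/

/-- The powers add up to `(n + 4) ^ (6 * (d * r) + 13)`, and `n + 4 ≤ n ^ 2` doubles the exponent.
With the factor `K ≤ n` this gives `n ^ 27 * n ^ (12 * (d * r))`. Finally `r ≤ 6 * L * log₂ n` turns
`12` into `72`. -/
theorem time_le {K L d n : ℕ} (hn : 4 ≤ n) (hK : K ≤ n) {M : ℕ}
    (hM : M + 1 ≤ (n + 4) ^ (2 * (d * (3 * L * (Nat.log 2 n + 1))) + 3)) :
    ((K * ((M + 1) ^ 3 * (n + 4) ^ 4) : ℕ) : ℝ) ≤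
      (n : ℝ) ^ 27 * (2 : ℝ) ^ ((72 * L : ℝ) * (d : ℝ) * Real.logb 2 n ^ 4) := by
  set r := 3 * L * (Nat.log 2 n + 1) with hr
  have h₁ : K * ((M + 1) ^ 3 * (n + 4) ^ 4) ≤ n ^ 27 * n ^ (12 * (d * r)) := by
    calc _ ≤ n * (((n + 4) ^ (2 * (d * r) + 3)) ^ 3 * (n + 4) ^ 4) := by gcongr
      _ = n * (n + 4) ^ (6 * (d * r) + 13) := by ring
      _ ≤ n * (n ^ 2) ^ (6 * (d * r) + 13) := by
        gcongr
        nlinarith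
      _ = _ := by ring
  have hn0 : (0 : ℝ) < n := by exact_mod_cast (by omega : 0 < n)
  have hlog1 : 1 ≤ Real.logb 2 n := by
    rw [Real.le_logb_iff_rpow_le (by norm_num) hn0, Real.rpow_one]
    exact_mod_cast (by omega : 2 ≤ n)
  have hlog : ((Nat.log 2 n + 1 : ℕ) : ℝ) ≤ 2 * Real.logb 2 n := by
    have : ((Nat.log 2 n : ℕ) : ℝ) ≤ Real.logb 2 n := Real.natLog_le_logb n 2
    push_cast
    linarith
  have h₂ : (n : ℝ) ^ (12 * (d * r)) ≤
      (2 : ℝ) ^ ((72 * L : ℝ) * (d : ℝ) * Real.logb 2 n ^ 4) := by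
    have hn2 : (n : ℝ) = (2 : ℝ) ^ Real.logb 2 n :=
      (Real.rpow_logb (by norm_num) (by norm_num) hn0).symm
    calc (n : ℝ) ^ (12 * (d * r)) = (2 : ℝ) ^ (Real.logb 2 n * (12 * (d * r) : ℕ)) := by
          rw [Real.rpow_mul (by norm_num), ← hn2, Real.rpow_natCast]
      _ ≤ _ := by
        refine Real.rpow_le_rpow_of_exponent_le (by norm_num) ?_
        rw [hr]
        -- The argument yields the exponent `2` of the logarithm; passing to `4` is slack.
        have h₃ : Real.logb 2 n ^ 2 ≤ Real.logb 2 n ^ 4 :=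
          pow_le_pow_right₀ hlog1 (by norm_num)
        calc Real.logb 2 n * ((12 * (d * (3 * L * (Nat.log 2 n + 1))) : ℕ) : ℝ)
            = 36 * L * d * Real.logb 2 n * ((Nat.log 2 n + 1 : ℕ) : ℝ) := by push_cast; ring
          _ ≤ 36 * L * d * Real.logb 2 n * (2 * Real.logb 2 n) := by gcongr
          _ = 72 * L * d * Real.logb 2 n ^ 2 := by ring
          _ ≤ _ := by gcongr
  calc _ ≤ ((n ^ 27 * n ^ (12 * (d * r)) : ℕ) : ℝ) := by exact_mod_cast h₁
    _ = (n : ℝ) ^ 27 * (n : ℝ) ^ (12 * (d * r)) := by push_cast; ring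
    _ ≤ _ := by gcongr

namespace RAM

/-- The members `≤ d` of `σ` and of `ρ`. -/
noncomputable def memberLists (d : ℕ) (σ ρ : Set ℕ) (x : ℕ) : List ℕ :=
  open Classical in
  ((Finset.range (d + 1)).filter fun t => t ∈ if x = 1 then σ else ρ).toList

theorem solveProg_isAnswer {σ ρ : Set ℕ} (hσ : FinOrCofin σ) (hρ : FinOrCofin ρ) (goal : Goal)
    {n : ℕ} (G : SimpleGraph (Fin n)) :
    ∃ out t, Outputs (solveProg goal (dPair σ ρ) (memberLists (dPair σ ρ) σ ρ)) G out t ∧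
      IsAnswer goal σ ρ G out ∧
      t ≤ (9 * pairConst (dPair σ ρ) (memberLists (dPair σ ρ) σ ρ) + 140) *
        (((entries G (dPair σ ρ) σ ρ).card + 1) ^ 3 * (n + 4) ^ 4) := by
  have h₁ : ∀ t ≤ dPair σ ρ, t ∈ memberLists (dPair σ ρ) σ ρ 1 ↔ t ∈ σ := by
    intro t ht
    simp [memberLists, ht]
  have h₂ : ∀ t ≤ dPair σ ρ, t ∈ memberLists (dPair σ ρ) σ ρ 0 ↔ t ∈ ρ := by
    intro t ht
    simp [memberLists, ht]
  obtain ⟨m, t, he, ht, L, hL, hL', hd, ho⟩ := solveProg_spec (goal := goal) (m := inputMem G)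
    (by simp [inputMem]) rfl (fun i => by simp [inputMem]) (closed_entries G h₁ h₂)
    (initialEntries_subset G).2.2
  rw [values_eq_sigmaRhoSizes G h₁ h₂ hσ hρ (le_max_left _ _) (le_max_right _ _) hL hL' hd] at ho
  exact ⟨_, t, ⟨m, he, rfl⟩, ho, ht⟩

end RAM

theorem dPair_singleton_zero_univ : dPair {0} Set.univ = 1 := by
  rw [dPair, dSet_univ, dSet_of_isGreatest (isGreatest_singleton (a := 0))]
  rfl

theorem dPair_univ_Ici_one : dPair Set.univ (Set.Ici 1) = 1 := by
  rw [dPair, dSet_univ, dSet_of_isGreatest_compl (k := 0)]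
  · rfl
  · simp [IsGreatest, upperBounds]

theorem isSigmaRhoSet_singleton_zero_univ_iff {n : ℕ} (G : SimpleGraph (Fin n))
    (X : Set (Fin n)) : IsSigmaRhoSet G {0} Set.univ X ↔ G.IsIndepSet X := by
  simp only [IsSigmaRhoSet, Set.mem_singleton_iff, Set.mem_univ, implies_true, and_true,
    Set.ncard_eq_zero (Set.toFinite _), Set.eq_empty_iff_forall_notMem, Set.mem_inter_iff,
    SimpleGraph.mem_neighborSet, SimpleGraph.IsIndepSet, Set.Pairwise]
  exact ⟨fun h v hv w hw _ hvw => h v hv w ⟨hvw, hw⟩,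
    fun h v hv w hw => h hv hw.2 hw.1.ne hw.1⟩

theorem isSigmaRhoSet_univ_Ici_one_iff {n : ℕ} (G : SimpleGraph (Fin n)) (X : Set (Fin n)) :
    IsSigmaRhoSet G Set.univ (Set.Ici 1) X ↔ ∀ v, v ∉ X → ∃ u ∈ X, G.Adj v u := by
  simp only [IsSigmaRhoSet, Set.mem_univ, implies_true, true_and, Set.mem_Ici,
    Nat.one_le_iff_ne_zero, Ne, Set.ncard_eq_zero (Set.toFinite _), ← Set.not_nonempty_iff_eq_empty,
    not_not]
  refine forall₂_congr fun v _ => ⟨?_, ?_⟩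
  · rintro ⟨u, h, hu⟩
    exact ⟨u, hu, h⟩
  · rintro ⟨u, hu, h⟩
    exact ⟨u, h, hu⟩

-- Having `0 < p` inside the existential makes `L` a function of `p` alone, as required for the
-- constant `C p`.
open unitInterval in
theorem exists_pow_symm_le_half (p : unitInterval) :
    ∃ L : ℕ, 0 < p → toNNReal (σ p) ^ L ≤ 2⁻¹ := by
  by_cases hp : 0 < p
  · have h : toNNReal (σ p) < 1 := by
      have : (0 : ℝ) < p := hp
      rw [← NNReal.coe_lt_coe]
      simpa using this
    obtain ⟨L, hL⟩ := exists_pow_lt_of_lt_one (show (0 : NNReal) < 2⁻¹ by positivity) h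
    exact ⟨L, fun _ => hL.le⟩
  · exact ⟨0, fun h => absurd h hp⟩

theorem mainTheorem5 :
    (∃ (c : ℕ) (C : unitInterval → ℝ), ∀ (goal : Goal) (σ ρ : Set ℕ),
      FinOrCofin σ → FinOrCofin ρ →
        ∃ P : RAM.Prog, RAM.Solves P goal σ ρ ∧
          ∀ p : unitInterval, 0 < p →
            Filter.Tendsto
              (fun n : ℕ => SimpleGraph.binomialRandom (Fin n) p
                {G : SimpleGraph (Fin n) | RAM.HaltsWithin P G
                  ((n : ℝ) ^ c *
                    (2 : ℝ) ^ (C p * (dPair σ ρ : ℝ) * Real.logb 2 (n : ℝ) ^ 4))})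
              Filter.atTop (nhds 1)) ∧
    -- the independent sets are the `({0}, ℕ)`-sets
    (∀ (n : ℕ) (G : SimpleGraph (Fin n)) (X : Set (Fin n)),
      IsSigmaRhoSet G {0} Set.univ X ↔ G.IsIndepSet X) ∧
    -- the dominating sets are the `(ℕ, {1, 2, …})`-sets
    (∀ (n : ℕ) (G : SimpleGraph (Fin n)) (X : Set (Fin n)),
      IsSigmaRhoSet G Set.univ (Set.Ici 1) X ↔ ∀ v, v ∉ X → ∃ u ∈ X, G.Adj v u) ∧
    dPair {0} Set.univ = 1 ∧ dPair Set.univ (Set.Ici 1) = 1 := by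
  refine ⟨?_, fun n => isSigmaRhoSet_singleton_zero_univ_iff,
    fun n => isSigmaRhoSet_univ_Ici_one_iff, dPair_singleton_zero_univ, dPair_univ_Ici_one⟩
  choose L hL using exists_pow_symm_le_half
  refine ⟨27, fun p => 72 * L p, fun goal σ ρ hσ hρ => ?_⟩
  have hrun := fun {n : ℕ} => RAM.solveProg_isAnswer hσ hρ goal (n := n)
  refine ⟨RAM.solveProg goal (dPair σ ρ) (RAM.memberLists (dPair σ ρ) σ ρ), fun n G => ?_,
    fun p hp => ?_⟩
  · obtain ⟨out, t, h₁, h₂, -⟩ := hrun G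
    exact ⟨out, t, h₁, h₂⟩
  · have hlim := ENNReal.Tendsto.sub tendsto_const_nhds
      (SimpleGraph.tendsto_binomialRandom_hasCrossMatching p (hL p hp))
      (.inl ENNReal.one_ne_top)
    rw [tsub_zero] at hlim
    refine tendsto_of_tendsto_of_tendsto_of_le_of_le' hlim tendsto_const_nhds ?_
      (.of_forall fun n => MeasureTheory.prob_le_one)
    -- The constant of the program depends on `σ` and `ρ`. For large `n` it is at most `n`, so the
    -- exponent `27` is uniform.
    filter_upwards [Filter.eventually_ge_atTop (9 * RAM.pairConst (dPair σ ρ)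
      (RAM.memberLists (dPair σ ρ) σ ρ) + 140)] with n hn
    rw [tsub_le_iff_right, ← MeasureTheory.measure_univ
      (μ := SimpleGraph.binomialRandom (Fin n) p)]
    -- Every graph either has a large cross matching or is solved in time, so subadditivity bounds
    -- the probability of success from below.
    refine (MeasureTheory.measure_mono fun G _ => ?_).trans (MeasureTheory.measure_union_le _ _)
    by_cases hG : G.HasCrossMatching (3 * L p * (Nat.log 2 n + 1) + 1)
    · exact .inr hG
    · obtain ⟨out, t, h₁, -, h₂⟩ := hrun G
      refine .inl ⟨out, t, h₁, (Nat.cast_le.2 h₂).trans ?_⟩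
      exact time_le (by omega) hn (RAM.card_entries_le hG _ σ ρ)
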